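/- Let $(W,S)$, $S=\{s_1,s_2,s_3\}$, be an affine Coxeter system of rank two, that is, with $m_{ij}$ the order of $s_is_j$, $(m_{12},m_{23},m_{13})$ is $(3,3,3)$ (type $\tilde A_2$), $(4,2,4)$ (type $\tilde C_2$) or $(6,2,3)$ (type $\tilde G_2$), and let $\ell$ be its length function. Let $W$ act on the Euclidean plane so that $s_1,s_2,s_3$ are the orthogonal reflections in the three sides of an open triangle $\mathscr C$ (the fundamental chamber), the sides of $s_i$ and $s_j$ meeting at the angle $\pi/m_{ij}$. Let $v_i$ be the vertex of $\mathscr C$ opposite to the side of $s_i$, and take $v_3$ as the origin. The walls are the fixed lines of the reflections in $W$. For $i=1,2$ let $\mathscr T_i$ be the connected component containing $\mathscr C$ of the complement of the union of all walls parallel to the vector $v_i$. For $g\in W$ the straight strip $g\mathscr T_i$ has as its direction the image of $v_i$ under the linear part of $g$, and its stabilizer consists of the elements of $W$ that map $g\mathscr T_i$ to itself and preserve this direction. Let $w_i$ be the element of the stabilizer of $g_i\mathscr T_i$ that acts on the middle line of this strip as the minimal translation in its (positive) direction, where $g_1=s_1$ in type $\tilde G_2$ and $g_i=1$ in all other cases.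 Put $H_i=\{w_i^n : n\ge 0\}$. Let $k$ be a commutative ring (for instance a field) and $q\in k$. Let $H_q(W,S)$ be the associative unital $k$-algebra with generators $e_w$ ($w\in W$) and relations $e_1=1$, $(e_s+1)(e_s-q)=0$ for $s\in S$, and $e_we_v=e_{wv}$ whenever $\ell(wv)=\ell(w)+\ell(v)$. For a representation $\rho$ of $H_q(W,S)$ on a $k$-module $V$ and a subset $D\subseteq W$, put $$D(\rho,u)=\sum_{w\in D}\rho(e_w)\,u^{\ell(w)}\in \mathrm{End}_k(V)[[u]];$$ this is invertible if $1\in D$. For $I\subseteq S$ let $W_I$ be the subgroup generated by $I$. Theorem. The elements $w_1$ and $w_2$ exist and are unique. For every representation $\rho$ of $H_q(W,S)$ there is an ordering of the nine factors $$H_1(\rho,u),\qquad H_2(\rho,u),\qquad W_I(\rho,u)^{(-1)^{|I|}}\quad (I\subsetneq S)$$ such that their product in this ordering is equal to $W(\rho,u)$. -/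

import Mathlib

open scoped ComplexConjugate

noncomputable section

/-! ### Affine Coxeter groups of rank two -/

/-- The three types `Ã₂`, `C̃₂`, `G̃₂` of affine Coxeter systems of rank two. -/
inductive AffineType
  | A2
  | C2
  | G2

namespace AffineType

/-- The Coxeter matrix `(m i j)`. The simple reflections `s₁, s₂, s₃` have indices `0, 1, 2`, and
`(m₁₂, m₂₃, m₁₃)` is `(3, 3, 3)`, `(4, 2, 4)`, `(6, 2, 3)` in the types `Ã₂`, `C̃₂`, `G̃₂`. -/
def coxeterMatrix : AffineType → CoxeterMatrix (Fin 3)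
  | A2 =>
    { M := !![1, 3, 3; 3, 1, 3; 3, 3, 1]
      isSymm := by ext i j; fin_cases i <;> fin_cases j <;> rfl
      diagonal := by intro i; fin_cases i <;> rfl
      off_diagonal := by intro i j; fin_cases i <;> fin_cases j <;> simp }
  | C2 =>
    { M := !![1, 4, 4; 4, 1, 2; 4, 2, 1]
      isSymm := by ext i j; fin_cases i <;> fin_cases j <;> rfl
      diagonal := by intro i; fin_cases i <;> rfl
      off_diagonal := by intro i j; fin_cases i <;> fin_cases j <;> simp }
  | G2 =>
    { M := !![1, 6, 3; 6, 1, 2; 3, 2, 1]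
      isSymm := by ext i j; fin_cases i <;> fin_cases j <;> rfl
      diagonal := by intro i; fin_cases i <;> rfl
      off_diagonal := by intro i j; fin_cases i <;> fin_cases j <;> simp }

/-! ### The geometric realization

The Euclidean plane is `ℂ` with its real inner product. The fundamental chamber is a triangle with
vertices `v₁, v₂, v₃`, where `v₃ = 0`, and with angle `π / m i j` at the vertex that is opposite to
the side number `k`, for `{i, j, k} = {1, 2, 3}`. -/

/-- The vertices `v₁, v₂, v₃` (with indices `0, 1, 2`) of the fundamental chamber. -/
def vertex : AffineType → Fin 3 → ℂ
  | A2 => ![⟨1 / 2, √3 / 2⟩, 1, 0]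
  | C2 => ![⟨1 / 2, 1 / 2⟩, 1, 0]
  | G2 => ![⟨3 / 4, √3 / 4⟩, 1, 0]

/-- The orthogonal reflection in the line through the vertices `v (i+1)` and `v (i+2)` of the
fundamental chamber (indices modulo `3`), the side opposite to `v i`. -/
def sideReflection (t : AffineType) (i : Fin 3) : ℂ ≃ᵃⁱ[ℝ] ℂ :=
  EuclideanGeometry.reflection (affineSpan ℝ {t.vertex (i + 1), t.vertex (i + 2)})

/-- The fundamental chamber: the open triangle with vertices `v₁, v₂, v₃`. -/
def chamber (t : AffineType) : Set ℂ :=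
  interior (convexHull ℝ (Set.range t.vertex))

end AffineType

theorem reflection_line_apply {a b : ℂ} (h : b - a ≠ 0) (z : ℂ) :
    EuclideanGeometry.reflection (affineSpan ℝ {a, b}) z
      = a + (b - a) / conj (b - a) * conj (z - a) := by
  have key : ∀ d v : ℂ, d ≠ 0 →
      (Submodule.span ℝ {d}).reflection v = d / conj d * conj v := by
    intro d v hd
    have hd' : conj d ≠ 0 := by simpa using hd
    rw [Submodule.reflection_singleton_apply, two_smul]
    have h1 : ((‖d‖ : ℝ) : ℂ) ^ 2 = d * conj d := by
      rw [Complex.mul_conj, Complex.normSq_eq_norm_sq]; push_cast; rfl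
    have h2 : (2 : ℂ) * ((inner ℝ d v : ℝ) : ℂ) = conj d * v + d * conj v := by
      rw [Complex.inner]
      apply Complex.ext <;> simp <;> ring
    simp only [Complex.real_smul]
    push_cast
    have h3 : ∀ r : ℂ, 2 * r = conj d * v + d * conj v →
        r / (d * conj d) * d + r / (d * conj d) * d - v = d / conj d * conj v := by
      intro r hr
      field_simp
      linear_combination hr
    have := h3 _ h2
    rw [← h1] at this
    simpa using this
  rw [EuclideanGeometry.reflection_apply_of_mem _ _ (left_mem_affineSpan_pair ℝ a b)]
  have hdir : (affineSpan ℝ {a, b}).direction = Submodule.span ℝ {b - a} := by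
    rw [direction_affineSpan, vectorSpan_pair_rev]; rfl
  have h4 : ∀ v : ℂ, (affineSpan ℝ {a, b}).direction.reflection v
      = (Submodule.span ℝ {b - a}).reflection v := by
    intro v
    simp only [Submodule.reflection_apply, hdir]
  rw [h4, key _ _ h]
  simp only [vsub_eq_sub, vadd_eq_add]
  ring

theorem reflection_line_mul_pow {a b c : ℂ} {m : ℕ} (hb : b - a ≠ 0) (hc : c - a ≠ 0)
    (h : ((b - a) * conj (c - a)) ^ m = (conj (b - a) * (c - a)) ^ m) :
    (EuclideanGeometry.reflection (affineSpan ℝ {a, b}) *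
      EuclideanGeometry.reflection (affineSpan ℝ {a, c})) ^ m = 1 := by
  have hb' : conj (b - a) ≠ 0 := (map_ne_zero _).mpr hb
  have hc' : conj (c - a) ≠ 0 := (map_ne_zero _).mpr hc
  have key : ∀ (n : ℕ) (z : ℂ), ((EuclideanGeometry.reflection (affineSpan ℝ {a, b}) *
      EuclideanGeometry.reflection (affineSpan ℝ {a, c})) ^ n) z
      = a + (((b - a) * conj (c - a)) / (conj (b - a) * (c - a))) ^ n * (z - a) := by
    intro n
    induction n with
    | zero => intro z; simp
    | succ n ih =>
      intro z
      rw [pow_succ, AffineIsometryEquiv.coe_mul, Function.comp_apply, ih,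
        AffineIsometryEquiv.coe_mul, Function.comp_apply, reflection_line_apply hb, reflection_line_apply hc, pow_succ]
      simp only [map_sub, map_mul, map_div₀, Complex.conj_conj, add_sub_cancel_left]
      simp only [map_sub] at hb' hc'
      field_simp
  ext z
  rw [key, div_pow, h, div_self (pow_ne_zero _ (mul_ne_zero hb' hc))]
  simp

theorem reflection_line_comm (a b : ℂ) :
    EuclideanGeometry.reflection (affineSpan ℝ {a, b})
      = EuclideanGeometry.reflection (affineSpan ℝ {b, a}) := by
  ext z
  exact EuclideanGeometry.eq_reflection_of_eq_subspace (by rw [Set.pair_comm]) z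

theorem AffineType.isLiftable_sideReflection (t : AffineType) :
    t.coxeterMatrix.IsLiftable t.sideReflection := by
  have h3 : (√3 : ℝ) ^ 2 = 3 := Real.sq_sqrt (by norm_num)
  have h4 : (√3 : ℝ) ^ 3 = 3 * √3 := by rw [pow_succ, h3]
  have h5 : (√3 : ℝ) ^ 4 = 9 := by rw [show 4 = 2 * 2 from rfl, pow_mul, h3]; norm_num
  have h6 : (√3 : ℝ) ^ 5 = 9 * √3 := by rw [pow_succ, h5]
  have h7 : (√3 : ℝ) ^ 6 = 27 := by rw [show 6 = 2 * 3 from rfl, pow_mul, h3]; norm_num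
  have hself : ∀ i, t.sideReflection i * t.sideReflection i = 1 := by
    intro i
    ext z
    simp [AffineType.sideReflection]
  have h01 : t.vertex 0 - t.vertex 1 ≠ 0 := by
    cases t <;> simp [AffineType.vertex, Complex.ext_iff] <;> norm_num
  have h02 : t.vertex 0 - t.vertex 2 ≠ 0 := by
    cases t <;> simp [AffineType.vertex, Complex.ext_iff]
  have h12 : t.vertex 1 - t.vertex 2 ≠ 0 := by
    cases t <;> simp [AffineType.vertex, Complex.ext_iff]
  have flip : ∀ x y : ℂ, x - y ≠ 0 → y - x ≠ 0 := fun x y h => by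
    rw [← neg_sub]; exact neg_ne_zero.mpr h
  have main : ∀ a b c : ℂ, ∀ m : ℕ, b - a ≠ 0 → c - a ≠ 0 →
      ((b - a) * conj (c - a)) ^ m = (conj (b - a) * (c - a)) ^ m →
      (EuclideanGeometry.reflection (affineSpan ℝ {a, b}) *
        EuclideanGeometry.reflection (affineSpan ℝ {a, c})) ^ m = 1 ∧
      (EuclideanGeometry.reflection (affineSpan ℝ {a, c}) *
        EuclideanGeometry.reflection (affineSpan ℝ {a, b})) ^ m = 1 := by
    intro a b c m hb hc h
    refine ⟨reflection_line_mul_pow hb hc h, reflection_line_mul_pow hc hb ?_⟩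
    rw [mul_comm (c - a), mul_comm (conj (c - a))]
    exact h.symm
  have c01 : ((t.vertex 0 - t.vertex 2) * conj (t.vertex 1 - t.vertex 2))
        ^ (t.coxeterMatrix 0 1) = (conj (t.vertex 0 - t.vertex 2) *
          (t.vertex 1 - t.vertex 2)) ^ (t.coxeterMatrix 0 1) := by
    cases t <;> apply Complex.ext <;>
      simp [AffineType.vertex, AffineType.coxeterMatrix, pow_succ] <;>
      ring_nf <;> (try simp only [h3, h4, h5, h6, h7]) <;> (try ring_nf)
  have c02 : ((t.vertex 0 - t.vertex 1) * conj (t.vertex 2 - t.vertex 1))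
        ^ (t.coxeterMatrix 0 2) = (conj (t.vertex 0 - t.vertex 1) *
          (t.vertex 2 - t.vertex 1)) ^ (t.coxeterMatrix 0 2) := by
    cases t <;> apply Complex.ext <;>
      simp [AffineType.vertex, AffineType.coxeterMatrix, pow_succ] <;>
      ring_nf <;> (try simp only [h3, h4, h5, h6, h7]) <;> (try ring_nf)
  have c12 : ((t.vertex 1 - t.vertex 0) * conj (t.vertex 2 - t.vertex 0))
        ^ (t.coxeterMatrix 1 2) = (conj (t.vertex 1 - t.vertex 0) *
          (t.vertex 2 - t.vertex 0)) ^ (t.coxeterMatrix 1 2) := by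
    cases t <;> apply Complex.ext <;>
      simp [AffineType.vertex, AffineType.coxeterMatrix, pow_succ] <;>
      ring_nf <;> (try simp only [h3, h4, h5, h6, h7]) <;> (try ring_nf)
  have e01 := main _ _ _ _ h02 h12 c01
  have e02 := main _ _ _ _ h01 (flip _ _ h12) c02
  have e12 := main _ _ _ _ (flip _ _ h01) (flip _ _ h02) c12
  have s0 : t.sideReflection 0
      = EuclideanGeometry.reflection (affineSpan ℝ {t.vertex 1, t.vertex 2}) := rfl
  have s1 : t.sideReflection 1
      = EuclideanGeometry.reflection (affineSpan ℝ {t.vertex 2, t.vertex 0}) := rfl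
  have s2 : t.sideReflection 2
      = EuclideanGeometry.reflection (affineSpan ℝ {t.vertex 0, t.vertex 1}) := rfl
  rw [reflection_line_comm (t.vertex 2) (t.vertex 1), ← s0, ← s1] at e01
  rw [reflection_line_comm (t.vertex 1) (t.vertex 0), ← s0, ← s2] at e02
  rw [reflection_line_comm (t.vertex 0) (t.vertex 2), ← s1, ← s2] at e12
  have hd : ∀ i, (t.sideReflection i * t.sideReflection i) ^ t.coxeterMatrix i i = 1 := by
    intro i
    rw [hself, one_pow]
  have hsymm : ∀ i j, t.coxeterMatrix i j = t.coxeterMatrix j i :=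
    fun i j => t.coxeterMatrix.symmetric i j
  intro i j
  fin_cases i <;> fin_cases j
  · exact hd 0
  · exact e01.2
  · exact e02.2
  · exact (hsymm 1 0) ▸ e01.1
  · exact hd 1
  · exact e12.2
  · exact (hsymm 2 0) ▸ e02.1
  · exact (hsymm 2 1) ▸ e12.1
  · exact hd 2

section Geometry

variable {W : Type*} [Group W] {t : AffineType} (cs : CoxeterSystem t.coxeterMatrix W)

/-- The action of `W` on the Euclidean plane: the simple reflection `sᵢ` acts as the orthogonal
reflection in the `i`-th side of the fundamental chamber. -/
def planeAction : W →* (ℂ ≃ᵃⁱ[ℝ] ℂ) :=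
  cs.lift ⟨t.sideReflection, t.isLiftable_sideReflection⟩

/-- The wall of a reflection `r` of `W`: its set of fixed points in the plane. -/
def wall (r : W) : Set ℂ := {z | planeAction cs r z = z}

/-- The union of all walls that are parallel to the vector `d`. -/
def parallelWalls (d : ℂ) : Set ℂ :=
  {z | ∃ r, cs.IsReflection r ∧ (∀ x ∈ wall cs r, x + d ∈ wall cs r) ∧ z ∈ wall cs r}

/-- The fundamental straight strip `𝒯ᵢ` (`i = 1, 2`, with indices `0, 1`): the connected component
containing the fundamental chamber of the complement of the walls parallel to the vector `vᵢ`. -/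
def fundamentalStrip (i : Fin 2) : Set ℂ :=
  ⋃ z ∈ t.chamber, connectedComponentIn (parallelWalls cs (t.vertex i.castSucc))ᶜ z

/-- The straight strip `g 𝒯ᵢ`. -/
def strip (g : W) (i : Fin 2) : Set ℂ := planeAction cs g '' fundamentalStrip cs i

/-- The direction of the straight strip `g 𝒯ᵢ`: the image of `vᵢ` under the linear part of `g`. -/
def stripDirection (g : W) (i : Fin 2) : ℂ :=
  (planeAction cs g).linearIsometryEquiv (t.vertex i.castSucc)

/-- The stabilizer of the straight strip `g 𝒯ᵢ`: the elements of `W` that map the strip to itself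
and preserve its direction. -/
def stripStabilizer (g : W) (i : Fin 2) : Subgroup W where
  carrier := {w | planeAction cs w '' strip cs g i = strip cs g i ∧
    (planeAction cs w).linearIsometryEquiv (stripDirection cs g i) = stripDirection cs g i}
  one_mem' := by
    refine ⟨by simp, ?_⟩
    rw [map_one]
    rfl
  mul_mem' := by
    rintro a b ⟨ha, ha'⟩ ⟨hb, hb'⟩
    refine ⟨?_, ?_⟩
    · rw [map_mul, AffineIsometryEquiv.coe_mul, Set.image_comp, hb, ha]
    · rw [map_mul]
      change (planeAction cs a).linearIsometryEquiv ((planeAction cs b).linearIsometryEquiv _) = _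
      rw [hb', ha']
  inv_mem' := by
    rintro a ⟨ha, ha'⟩
    refine ⟨?_, ?_⟩
    · conv_lhs => rw [← ha]
      rw [← Set.image_comp, ← AffineIsometryEquiv.coe_mul, ← map_mul, inv_mul_cancel]
      simp
    · rw [map_inv]
      change (planeAction cs a).linearIsometryEquiv.symm _ = _
      rw [LinearIsometryEquiv.symm_apply_eq, ha']

/-- The middle line of a strip: the set of its centres of symmetry. -/
def middleLine (T : Set ℂ) : Set ℂ := {z | Equiv.pointReflection z '' T = T}

/-- `w` acts on the middle line of the straight strip `g 𝒯ᵢ` as the translation by `c` times the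
direction of the strip. -/
def TranslatesMiddleLine (g : W) (i : Fin 2) (w : W) (c : ℝ) : Prop :=
  ∀ z ∈ middleLine (strip cs g i), planeAction cs w z = z + c • stripDirection cs g i

/-- `w` is the element of the stabilizer of the straight strip `g 𝒯ᵢ` that acts on the middle line
as the minimal translation in the (positive) direction of the strip. -/
def IsMinimalTranslation (g : W) (i : Fin 2) (w : W) : Prop :=
  w ∈ stripStabilizer cs g i ∧ ∃ c : ℝ, 0 < c ∧ TranslatesMiddleLine cs g i w c ∧
    ∀ w' ∈ stripStabilizer cs g i, ∀ c' : ℝ, 0 < c' → TranslatesMiddleLine cs g i w' c' → c ≤ c'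

/-- The element `g` such that `g 𝒯ᵢ` is the standard straight strip of type `i`: it is `s₁` for
`i = 1` in the type `G̃₂`, and `1` in all other cases. -/
def standardShift (i : Fin 2) : W :=
  match t, i with
  | .G2, 0 => cs.simple 0
  | _, _ => 1

/-- `w` is the generator `wᵢ` of the stabilizer of the standard straight strip of type `i`. -/
def IsStripGenerator (i : Fin 2) (w : W) : Prop :=
  IsMinimalTranslation cs (standardShift cs i) i w

end Geometry

/-! ### Hecke algebras and twisted Poincaré series -/

section Hecke

variable {B W : Type*} [Group W] {M : CoxeterMatrix B} (cs : CoxeterSystem M W)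
variable {k : Type*} [CommRing k] (q : k)

/-- The defining relations of the Hecke algebra, on the generators `e w` with `w` in `W`. -/
inductive HeckeRel : FreeAlgebra k W → FreeAlgebra k W → Prop
  | one : HeckeRel (FreeAlgebra.ι k 1) 1
  | quadratic (i : B) :
      HeckeRel ((FreeAlgebra.ι k (cs.simple i) + 1) *
        (FreeAlgebra.ι k (cs.simple i) - algebraMap k (FreeAlgebra k W) q)) 0
  | mul (w v : W) (h : cs.length (w * v) = cs.length w + cs.length v) :
      HeckeRel (FreeAlgebra.ι k w * FreeAlgebra.ι k v) (FreeAlgebra.ι k (w * v))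

/-- The Hecke algebra `H_q(W, S)` over `k`. -/
abbrev HeckeAlgebra : Type _ := RingQuot (HeckeRel cs q)

/-- The generator `e w` of the Hecke algebra. -/
def heckeGen (w : W) : HeckeAlgebra cs q :=
  RingQuot.mkAlgHom k (HeckeRel cs q) (FreeAlgebra.ι k w)

theorem finite_length_eq [Finite B] (D : Set W) (n : ℕ) :
    {w | w ∈ D ∧ cs.length w = n}.Finite := by
  refine ((List.finite_length_eq B n).image cs.wordProd).subset ?_
  rintro w ⟨-, hw⟩
  obtain ⟨ω, hω, rfl⟩ := cs.exists_isReduced w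
  exact ⟨ω, hω.symm.trans hw, rfl⟩

variable {q} {V : Type*} [AddCommGroup V] [Module k V]
variable (ρ : HeckeAlgebra cs q →ₐ[k] Module.End k V)

/-- The Poincaré series `D(ρ, u) = ∑ ρ(e w) u ^ ℓ(w)` (sum over `w` in `D`) twisted by `ρ`. -/
def poincareSeries [Finite B] (D : Set W) : PowerSeries (Module.End k V) :=
  PowerSeries.mk fun n => ∑ w ∈ (finite_length_eq cs D n).toFinset, ρ (heckeGen cs q w)

theorem constantCoeff_poincareSeries [Finite B] {D : Set W} (hD : 1 ∈ D) :
    PowerSeries.constantCoeff (poincareSeries cs ρ D) = 1 := by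
  have h : (finite_length_eq cs D 0).toFinset = {1} := by
    ext w
    simp only [Set.Finite.mem_toFinset, Set.mem_ofPred_eq, Finset.mem_singleton,
      cs.length_eq_zero_iff]
    exact ⟨fun h => h.2, fun h => ⟨h ▸ hD, h⟩⟩
  rw [← PowerSeries.coeff_zero_eq_constantCoeff_apply, poincareSeries, PowerSeries.coeff_mk, h,
    Finset.sum_singleton, heckeGen, RingQuot.mkAlgHom_rel k HeckeRel.one, map_one, map_one]

/-- The twisted Poincaré series of a set `D` containing the identity, as an invertible power
series. -/
def poincareUnit [Finite B] (D : Set W) (hD : 1 ∈ D) : (PowerSeries (Module.End k V))ˣ :=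
  (PowerSeries.isUnit_iff_constantCoeff.mpr
    (by rw [constantCoeff_poincareSeries cs ρ hD]; exact isUnit_one)).unit

theorem val_poincareUnit [Finite B] (D : Set W) (hD : 1 ∈ D) :
    (poincareUnit cs ρ D hD : PowerSeries (Module.End k V)) = poincareSeries cs ρ D := rfl

/-- The parabolic subgroup `W_I` generated by the simple reflections with index in `I`. -/
def parabolic (I : Finset B) : Subgroup W := Subgroup.closure (cs.simple '' I)

end Hecke

section Factors

variable {W : Type*} [Group W] {M : CoxeterMatrix (Fin 3)} (cs : CoxeterSystem M W)
variable {k : Type*} [CommRing k] {q : k} {V : Type*} [AddCommGroup V] [Module k V]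
variable (ρ : HeckeAlgebra cs q →ₐ[k] Module.End k V)

/-- The labels of the factors: `1, 2` (indices `0, 1`) for `H₁, H₂`, and the proper subsets `I` of
`S`. -/
abbrev FactorLabel : Type := Fin 2 ⊕ {I : Finset (Fin 3) // I ≠ Finset.univ}

/-- The factors `Hᵢ(ρ, u)`, where `Hᵢ` is the set of the powers `(w i) ^ n` with `n ≥ 0`, and
`W_I(ρ, u) ^ ((-1) ^ |I|)` for `I` a proper subset of `S`. -/
def factor (w : Fin 2 → W) : FactorLabel → (PowerSeries (Module.End k V))ˣ
  | .inl i => poincareUnit cs ρ (Submonoid.powers (w i)) (one_mem _)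
  | .inr I => poincareUnit cs ρ (parabolic cs I.1) (one_mem _) ^ ((-1 : ℤ) ^ I.1.card)

end Factors

end

/-!
Write `W^I` for the set of minimal coset representatives of `W_I`. Since
`W(ρ, u) = W^I(ρ, u) W_I(ρ, u)` and `∑_I (-1)^|I| W^I` counts `w` with weight `1` exactly when
every simple reflection is a right descent of `w`, which never happens in an infinite Coxeter
group, `W(ρ, u)⁻¹` is the alternating sum of the series `W_I(ρ, u)⁻¹` over the proper subsets `I`.
The generators of the strips are straight, `ℓ(wⁿ) = n ℓ(w)`, so that `H_i(ρ, u)⁻¹` is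
`1 - ρ(e_{w_i}) u^ℓ(w_i)`. The theorem is thereby an identity between finitely many noncommutative
polynomials in the `ρ(e_s) u`, one for each type, and it follows from the braid relations.

Lengths are controlled by the representation of `W` on the affine root lattice: `s_i` is a right
descent of `w` exactly when `w α_i` is a negative root. The same representation describes the
geometry. The walls parallel to `v_i` are the lines on which `α_j` takes integral values, for one
affine root `α_j`, and so the strip is `0 < α_j < 1`. An element of its stabilizer is determined by
its action on `α_j` and on a linear form that grows along the strip, and divisibility in the root
lattice bounds the possible translations from below.
-/

noncomputable section

section Descents

variable {B W : Type*} [Group W] {M : CoxeterMatrix B} (cs : CoxeterSystem M W)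

/-- The set `W^I` of the elements of minimal length in their cosets `w W_I`. -/
def minimalCosetReps (I : Finset B) : Set W := {w | ∀ i ∈ I, ¬ cs.IsRightDescent w i}

variable {cs}

theorem eq_one_of_forall_not_isRightDescent {w : W} (h : ∀ i, ¬ cs.IsRightDescent w i) :
    w = 1 := by
  by_contra hw
  obtain ⟨i, hi⟩ := cs.exists_rightDescent_of_ne_one hw
  exact h i hi

theorem minimalCosetReps_univ [Fintype B] : minimalCosetReps cs Finset.univ = {1} := by
  refine Set.Subset.antisymm (fun w hw => eq_one_of_forall_not_isRightDescent fun i =>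
    hw i (Finset.mem_univ i)) ?_
  rintro _ rfl i -
  exact cs.not_isRightDescent_one i

theorem simple_mem_parabolic {I : Finset B} {i : B} (h : i ∈ I) :
    cs.simple i ∈ parabolic cs I :=
  Subgroup.subset_closure ⟨i, h, rfl⟩

@[elab_as_elim]
theorem parabolic_induction {I : Finset B} {P : ∀ w, w ∈ parabolic cs I → Prop}
    (one : P 1 (one_mem _))
    (simple_mul : ∀ i (hi : i ∈ I) w hw, P w hw →
      P (cs.simple i * w) (mul_mem (simple_mem_parabolic hi) hw))
    {w : W} (hw : w ∈ parabolic cs I) : P w hw := by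
  induction hw using Subgroup.closure_induction_left with
  | one => exact one
  | mul_left _ hx w hw ih =>
    obtain ⟨i, hi, rfl⟩ := hx
    exact simple_mul i hi w hw ih
  | inv_mul_cancel _ hx w hw ih =>
    obtain ⟨i, hi, rfl⟩ := hx
    simp only [cs.inv_simple]
    exact simple_mul i hi w hw ih

theorem exists_minimalCosetReps_mul_parabolic (I : Finset B) (w : W) :
    ∃ a ∈ minimalCosetReps cs I, ∃ b ∈ parabolic cs I, a * b = w := by
  induction hn : cs.length w using Nat.strong_induction_on generalizing w with
  | _ n ih =>
  by_cases hw : w ∈ minimalCosetReps cs I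
  · exact ⟨w, hw, 1, one_mem _, mul_one w⟩
  simp only [minimalCosetReps, Set.mem_ofPred_eq, not_forall, not_not] at hw
  obtain ⟨i, hi, hd⟩ := hw
  obtain ⟨a, ha, b, hb, hab⟩ := ih _ (hn ▸ hd) (w * cs.simple i) rfl
  refine ⟨a, ha, b * cs.simple i, mul_mem hb (simple_mem_parabolic hi), ?_⟩
  rw [← mul_assoc, hab, cs.simple_mul_simple_cancel_right]

theorem bijOn_minimalCosetReps_mul_parabolic {I : Finset B}
    (hlen : ∀ w ∈ minimalCosetReps cs I, ∀ v ∈ parabolic cs I,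
      cs.length (w * v) = cs.length w + cs.length v) :
    Set.BijOn (fun p : W × W => p.1 * p.2) (minimalCosetReps cs I ×ˢ (parabolic cs I : Set W))
      Set.univ := by
  refine ⟨fun _ _ => Set.mem_univ _, ?_, fun w _ => ?_⟩
  · rintro ⟨w, v⟩ ⟨hw, hv⟩ ⟨w', v'⟩ ⟨hw', hv'⟩ (e : w * v = w' * v')
    have hx : v' * v⁻¹ ∈ parabolic cs I := mul_mem hv' (inv_mem hv)
    have hw_eq : w = w' * (v' * v⁻¹) := by rw [← mul_assoc, ← e, mul_inv_cancel_right]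
    have hw'_eq : w' = w * (v' * v⁻¹)⁻¹ := by rw [hw_eq, mul_inv_cancel_right]
    have h := hlen w' hw' _ hx
    have h' := hlen w hw _ (inv_mem hx)
    rw [← hw_eq] at h
    rw [← hw'_eq] at h'
    have hone : v' * v⁻¹ = 1 := cs.length_eq_zero_iff.mp (by omega)
    exact Prod.ext (by rw [hw_eq, hone, mul_one]) (mul_inv_eq_one.mp hone).symm
  · obtain ⟨a, ha, b, hb, hab⟩ := exists_minimalCosetReps_mul_parabolic (cs := cs) I w
    exact ⟨(a, b), ⟨ha, hb⟩, hab⟩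

open CoxeterSystem in
theorem exists_eq_mul_wordProd_alternatingWord {w : W} {i : B}
    (hi : ¬ cs.IsRightDescent w i) (j : B) :
    ∃ v k, w = v * cs.wordProd (alternatingWord i j k) ∧ cs.length w = cs.length v + k ∧
      ¬ cs.IsRightDescent v i ∧ ¬ cs.IsRightDescent v j := by
  induction hn : cs.length w using Nat.strong_induction_on generalizing w i j with
  | _ n ih =>
  by_cases hj : cs.IsRightDescent w j
  · obtain ⟨v, k, hv, hlen, hvj, hvi⟩ :=
      ih _ (hn ▸ hj) (cs.isRightDescent_iff_not_isRightDescent_mul.mp hj) i rfl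
    refine ⟨v, k + 1, ?_, ?_, hvi, hvj⟩
    · rw [alternatingWord_succ, cs.wordProd_concat, ← mul_assoc, ← hv,
        cs.simple_mul_simple_cancel_right]
    · rw [← hn, ← cs.isRightDescent_iff.mp hj, hlen, add_assoc]
  · exact ⟨w, 0, by simp [alternatingWord], hn.symm, hi, hj⟩

open CoxeterSystem in
theorem lt_of_not_isRightDescent_mul_alternatingWord {v : W} {i j : B} {k : ℕ} (hM : M i j ≠ 0)
    (hlen : cs.length (v * cs.wordProd (alternatingWord i j k)) = cs.length v + k)
    (hi : ¬ cs.IsRightDescent (v * cs.wordProd (alternatingWord i j k)) i) : k < M i j := by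
  have hred : cs.IsReduced (alternatingWord i j k) := by
    have h := cs.length_mul_le v (cs.wordProd (alternatingWord i j k))
    have h' := cs.length_wordProd_le (alternatingWord i j k)
    rw [length_alternatingWord] at h'
    rw [CoxeterSystem.IsReduced, length_alternatingWord]
    omega
  refine lt_of_le_of_ne (not_lt.mp fun hk => cs.not_isReduced_alternatingWord i j hM hk hred) ?_
  rintro rfl
  obtain ⟨m, hm⟩ := Nat.exists_eq_succ_of_ne_zero hM
  have hbraid : cs.wordProd (alternatingWord i j (M i j)) =
      cs.wordProd (alternatingWord i j m) * cs.simple i := by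
    have h := cs.wordProd_braidWord_eq i j
    rw [braidWord, braidWord, M.symmetric j i] at h
    rw [h, hm, alternatingWord_succ, cs.wordProd_concat]
  refine hi ?_
  rw [CoxeterSystem.IsRightDescent, hlen, hbraid, mul_assoc, cs.simple_mul_simple_cancel_right, hm]
  have h := cs.length_mul_le v (cs.wordProd (alternatingWord i j m))
  have h' := cs.length_wordProd_le (alternatingWord i j m)
  rw [length_alternatingWord] at h'
  omega

end Descents

section PoincareSeries

variable {B W : Type*} [Group W] {M : CoxeterMatrix B} {cs : CoxeterSystem M W}
variable {k : Type*} [CommRing k] {q : k} {V : Type*} [AddCommGroup V] [Module k V]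

theorem heckeGen_one : heckeGen cs q 1 = 1 := by
  rw [heckeGen, RingQuot.mkAlgHom_rel k HeckeRel.one, map_one]

theorem heckeGen_mul {w v : W} (h : cs.length (w * v) = cs.length w + cs.length v) :
    heckeGen cs q (w * v) = heckeGen cs q w * heckeGen cs q v := by
  rw [heckeGen, ← RingQuot.mkAlgHom_rel k (HeckeRel.mul w v h), map_mul, heckeGen, heckeGen]

variable (ρ : HeckeAlgebra cs q →ₐ[k] Module.End k V)

/-- The term `ρ(e w) u ^ ℓ(w)` of the twisted Poincaré series. -/
def poincareTerm (w : W) : PowerSeries (Module.End k V) :=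
  PowerSeries.monomial (cs.length w) (ρ (heckeGen cs q w))

theorem poincareTerm_one : poincareTerm ρ 1 = 1 := by
  rw [poincareTerm, cs.length_one, heckeGen_one, map_one, PowerSeries.monomial_zero_eq_C_apply,
    map_one]

theorem poincareTerm_mul {w v : W} (h : cs.length (w * v) = cs.length w + cs.length v) :
    poincareTerm ρ (w * v) = poincareTerm ρ w * poincareTerm ρ v := by
  rw [poincareTerm, poincareTerm, poincareTerm, PowerSeries.monomial_mul_monomial, h,
    heckeGen_mul h, map_mul]

theorem poincareTerm_wordProd {ω : List B} (h : cs.IsReduced ω) :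
    poincareTerm ρ (cs.wordProd ω) = (ω.map fun i => poincareTerm ρ (cs.simple i)).prod := by
  induction ω with
  | nil => rw [cs.wordProd_nil, poincareTerm_one, List.map_nil, List.prod_nil]
  | cons i ω ih =>
    have hω : cs.IsReduced ω := h.drop 1
    rw [cs.wordProd_cons, poincareTerm_mul, ih hω, List.map_cons, List.prod_cons]
    rw [← cs.wordProd_cons, h.eq, hω.eq, cs.length_simple, List.length_cons, add_comm]

variable [Finite B]

open Classical in
theorem coeff_poincareSeries (D : Set W) (n : ℕ) :
    PowerSeries.coeff n (poincareSeries cs ρ D) =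
      ∑ w ∈ (finite_length_eq cs Set.univ n).toFinset,
        if w ∈ D then ρ (heckeGen cs q w) else 0 := by
  rw [poincareSeries, PowerSeries.coeff_mk, ← Finset.sum_filter]
  congr 1
  ext w
  simp [and_comm]

theorem poincareSeries_empty : poincareSeries cs ρ ∅ = 0 := by
  ext1 n
  simp [coeff_poincareSeries]

theorem poincareSeries_singleton (w : W) : poincareSeries cs ρ {w} = poincareTerm ρ w := by
  classical
  ext1 n
  simp [coeff_poincareSeries, poincareTerm, PowerSeries.coeff_monomial, eq_comm]

theorem poincareSeries_union {D E : Set W} (h : Disjoint D E) :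
    poincareSeries cs ρ (D ∪ E) = poincareSeries cs ρ D + poincareSeries cs ρ E := by
  classical
  ext1 n
  simp only [map_add, coeff_poincareSeries, ← Finset.sum_add_distrib]
  refine Finset.sum_congr rfl fun w _ => ?_
  by_cases hD : w ∈ D
  · simp [hD, Set.disjoint_left.mp h hD]
  · simp [hD]

theorem poincareSeries_mul {D E F : Set W}
    (hlen : ∀ w ∈ D, ∀ v ∈ E, cs.length (w * v) = cs.length w + cs.length v)
    (hbij : Set.BijOn (fun p : W × W => p.1 * p.2) (D ×ˢ E) F) :
    poincareSeries cs ρ D * poincareSeries cs ρ E = poincareSeries cs ρ F := by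
  ext1 n
  simp only [PowerSeries.coeff_mul, poincareSeries, PowerSeries.coeff_mk, Finset.sum_mul_sum,
    ← Finset.sum_product', Finset.sum_sigma']
  refine Finset.sum_nbij (fun s => s.2.1 * s.2.2) ?_ ?_ ?_ ?_
  all_goals simp only [Set.InjOn, Set.SurjOn, Set.subset_def, Set.mem_image, Finset.mem_coe,
    Finset.mem_sigma, Finset.HasAntidiagonal.mem_antidiagonal, Finset.mem_product,
    Set.Finite.mem_toFinset, Set.mem_ofPred_eq, Sigma.forall, Sigma.exists, Prod.forall,
    Prod.exists]
  · rintro a b w v ⟨hab, ⟨hw, hwa⟩, hv, hvb⟩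
    exact ⟨hbij.mapsTo (Set.mk_mem_prod hw hv), by rw [hlen w hw v hv, hwa, hvb, hab]⟩
  · rintro _ _ w v ⟨-, ⟨hw, rfl⟩, hv, rfl⟩ _ _ w' v' ⟨-, ⟨hw', rfl⟩, hv', rfl⟩ e
    obtain ⟨rfl, rfl⟩ := Prod.mk.inj (hbij.injOn ⟨hw, hv⟩ ⟨hw', hv'⟩ e)
    rfl
  · rintro x ⟨hx, rfl⟩
    obtain ⟨⟨w, v⟩, ⟨hw, hv⟩, rfl⟩ := hbij.surjOn hx
    exact ⟨_, _, w, v, ⟨(hlen w hw v hv).symm, ⟨hw, rfl⟩, hv, rfl⟩, rfl⟩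
  · rintro _ _ w v ⟨-, ⟨hw, -⟩, hv, -⟩
    rw [heckeGen_mul (hlen w hw v hv), map_mul]

theorem poincareSeries_list {L : List (List B)} (hred : ∀ ω ∈ L, cs.IsReduced ω)
    (hnodup : (L.map cs.wordProd).Nodup) :
    poincareSeries cs ρ {w | w ∈ L.map cs.wordProd} =
      (L.map fun ω => (ω.map fun i => poincareTerm ρ (cs.simple i)).prod).sum := by
  induction L with
  | nil => simp [poincareSeries_empty]
  | cons ω L ih =>
    rw [List.map_cons, List.nodup_cons] at hnodup
    have hset : {w | w ∈ (ω :: L).map cs.wordProd} =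
        {cs.wordProd ω} ∪ {w | w ∈ L.map cs.wordProd} := by
      ext w
      simp
    have hdisj : Disjoint {cs.wordProd ω} {w | w ∈ L.map cs.wordProd} :=
      Set.disjoint_singleton_left.mpr hnodup.1
    rw [hset, poincareSeries_union ρ hdisj, poincareSeries_singleton,
      ih (fun ω' h => hred ω' (List.mem_cons_of_mem _ h)) hnodup.2,
      poincareTerm_wordProd ρ (hred ω List.mem_cons_self), List.map_cons, List.sum_cons]

theorem sum_neg_one_pow_smul_poincareSeries_minimalCosetReps {B : Type*} [Fintype B]
    {M : CoxeterMatrix B} {cs : CoxeterSystem M W} (ρ : HeckeAlgebra cs q →ₐ[k] Module.End k V) :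
    ∑ I : Finset B, (-1 : ℤ) ^ I.card • poincareSeries cs ρ (minimalCosetReps cs I) =
      poincareSeries cs ρ {w | ∀ i, cs.IsRightDescent w i} := by
  classical
  ext1 n
  simp only [map_sum, map_zsmul, coeff_poincareSeries, Finset.smul_sum]
  rw [Finset.sum_comm]
  refine Finset.sum_congr rfl fun w _ => ?_
  set A : Finset B := {i | ¬ cs.IsRightDescent w i} with hA
  have hmem (I : Finset B) : w ∈ minimalCosetReps cs I ↔ I ∈ A.powerset := by
    simp [hA, minimalCosetReps, Finset.subset_iff]
  have hempty : (∀ i, cs.IsRightDescent w i) ↔ A = ∅ := by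
    simp [hA, Finset.filter_eq_empty_iff]
  simp only [hmem, smul_ite, smul_zero, Set.mem_ofPred_eq, hempty, Finset.sum_ite_mem,
    Finset.univ_inter, ← Finset.sum_smul, Finset.sum_powerset_neg_one_pow_card, ite_smul, one_smul,
    zero_smul]

/-- The elements `w` of `W` with `ℓ(w ^ n) = n ℓ(w)` for all `n`. -/
def IsStraight (cs : CoxeterSystem M W) (w : W) : Prop :=
  ∀ n, cs.length (w ^ n) = n * cs.length w

theorem poincareSeries_powers_mul {w : W} (hw : w ≠ 1) (hstr : IsStraight cs w) :
    poincareSeries cs ρ (Submonoid.powers w) * (1 - poincareTerm ρ w) = 1 := by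
  set P : Set W := (Submonoid.powers w : Set W)
  have hlen (n : ℕ) : cs.length (w ^ n * w) = cs.length (w ^ n) + cs.length w := by
    rw [← pow_succ, hstr, hstr, Nat.succ_mul]
  have hmul : poincareSeries cs ρ P * poincareSeries cs ρ {w} =
      poincareSeries cs ρ ((· * w) '' P) := by
    refine poincareSeries_mul ρ ?_ ⟨?_, ?_, ?_⟩
    · rintro _ ⟨n, rfl⟩ _ rfl
      exact hlen n
    · rintro ⟨a, _⟩ ⟨ha, rfl⟩
      exact ⟨a, ha, rfl⟩
    · rintro ⟨a, _⟩ ⟨-, rfl⟩ ⟨a', _⟩ ⟨-, rfl⟩ e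
      exact Prod.ext (mul_right_cancel e) rfl
    · rintro _ ⟨a, ha, rfl⟩
      exact ⟨(a, w), ⟨ha, rfl⟩, rfl⟩
  have hunion : P = {1} ∪ (· * w) '' P := by
    refine Set.Subset.antisymm ?_ ?_
    · rintro _ ⟨_ | n, rfl⟩
      · exact Or.inl (pow_zero w)
      · exact Or.inr ⟨w ^ n, ⟨n, rfl⟩, (pow_succ w n).symm⟩
    · rintro _ (rfl | ⟨_, ⟨n, rfl⟩, rfl⟩)
      exacts [one_mem _, ⟨n + 1, pow_succ w n⟩]
  have hdisj : Disjoint {1} ((· * w) '' P) := by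
    rw [Set.disjoint_singleton_left]
    rintro ⟨_, ⟨n, rfl⟩, e : w ^ n * w = 1⟩
    have h := hlen n
    rw [e, cs.length_one] at h
    exact hw (cs.length_eq_zero_iff.mp (by omega))
  have hsplit : poincareSeries cs ρ P = 1 + poincareSeries cs ρ ((· * w) '' P) := by
    conv_lhs => rw [hunion]
    rw [poincareSeries_union ρ hdisj, poincareSeries_singleton, poincareTerm_one]
  rw [mul_sub, mul_one, ← poincareSeries_singleton, hmul, hsplit, add_sub_cancel_right]

theorem val_inv_poincareUnit_powers {w : W} (hw : w ≠ 1) (hstr : IsStraight cs w) :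
    ((poincareUnit cs ρ (Submonoid.powers w) (one_mem _))⁻¹ : (PowerSeries (Module.End k V))ˣ) =
      1 - poincareTerm ρ w :=
  Units.inv_eq_of_mul_eq_one_right (poincareSeries_powers_mul ρ hw hstr)

variable (cs) in
/-- The series `W_I(ρ, u)`, as an invertible power series. -/
abbrev parabolicUnit (I : Finset B) : (PowerSeries (Module.End k V))ˣ :=
  poincareUnit cs ρ (parabolic cs I) (one_mem _)

theorem poincareSeries_minimalCosetReps {I : Finset B}
    (hlen : ∀ w ∈ minimalCosetReps cs I, ∀ v ∈ parabolic cs I,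
      cs.length (w * v) = cs.length w + cs.length v) :
    poincareSeries cs ρ (minimalCosetReps cs I) = poincareSeries cs ρ Set.univ *
      ((parabolicUnit cs ρ I)⁻¹ : (PowerSeries (Module.End k V))ˣ) := by
  rw [← poincareSeries_mul ρ hlen (bijOn_minimalCosetReps_mul_parabolic hlen),
    ← val_poincareUnit cs ρ (parabolic cs I) (one_mem _), Units.mul_inv_cancel_right]

end PoincareSeries

namespace AffineType

/-- The Cartan matrix `A` of the untwisted affine root system: the reflection in the simple root
`αᵢ` maps `αⱼ` to `αⱼ - A i j • αᵢ`. -/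
def cartan : AffineType → Matrix (Fin 3) (Fin 3) ℤ
  | A2 => !![2, -1, -1; -1, 2, -1; -1, -1, 2]
  | C2 => !![2, -2, -2; -1, 2, 0; -1, 0, 2]
  | G2 => !![2, -1, -1; -3, 2, 0; -1, 0, 2]

/-- The simple root `αᵢ`, as a vector of the root lattice, which is identified with `ℤ³` by means
of the simple roots. -/
abbrev simpleRoot (i : Fin 3) : Fin 3 → ℤ := Pi.single i 1

/-- The basic imaginary root `δ`. -/
def delta : AffineType → Fin 3 → ℤ
  | A2 => ![1, 1, 1]
  | C2 => ![2, 1, 1]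
  | G2 => ![2, 3, 1]

/-- The reflection in the simple root `αᵢ`, acting on the root lattice. -/
def rootReflection (t : AffineType) (i : Fin 3) : Module.End ℤ (Fin 3 → ℤ) :=
  Module.preReflection (simpleRoot i) (LinearMap.proj i ∘ₗ t.cartan.mulVecLin)

/-- The product of the reflections in the simple roots named by the letters of a word. -/
def rootAction (t : AffineType) (ω : List (Fin 3)) : Module.End ℤ (Fin 3 → ℤ) :=
  (ω.map t.rootReflection).prod

theorem rootAction_append (t : AffineType) (ω ω' : List (Fin 3)) :
    t.rootAction (ω ++ ω') = t.rootAction ω * t.rootAction ω' := by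
  rw [rootAction, List.map_append, List.prod_append, rootAction, rootAction]

instance : DecidableEq (Module.End ℤ (Fin 3 → ℤ)) := fun _ _ =>
  decidable_of_iff _ (LinearMap.toMatrix' (R := ℤ)).injective.eq_iff

theorem rootReflection_apply (t : AffineType) (i : Fin 3) (p : Fin 3 → ℤ) :
    t.rootReflection i p = p - (t.cartan.mulVec p) i • simpleRoot i := rfl

theorem rootReflection_apply_of_ne (t : AffineType) {i j : Fin 3} (h : j ≠ i) (p : Fin 3 → ℤ) :
    t.rootReflection i p j = p j := by
  simp [rootReflection_apply, h]

theorem rootReflection_simpleRoot_self (t : AffineType) (i : Fin 3) :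
    t.rootReflection i (simpleRoot i) = -simpleRoot i := by
  have key : ∀ i l, t.rootReflection i (simpleRoot i) l = -simpleRoot i l := by
    cases t <;> decide
  exact funext (key i)

theorem rootReflection_delta (t : AffineType) (i : Fin 3) :
    t.rootReflection i t.delta = t.delta := by
  have key : ∀ i l, t.rootReflection i t.delta l = t.delta l := by cases t <;> decide
  exact funext (key i)

theorem delta_pos (t : AffineType) : ∀ i, 0 < t.delta i := by cases t <;> decide

theorem simpleRoot_nonneg (i : Fin 3) : 0 ≤ simpleRoot i := Pi.single_nonneg.mpr zero_le_one

theorem isLiftable_rootReflection (t : AffineType) :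
    t.coxeterMatrix.IsLiftable t.rootReflection := by
  intro i j
  revert i j
  cases t <;> decide +kernel

theorem coxeterMatrix_ne_zero (t : AffineType) (i j : Fin 3) : t.coxeterMatrix i j ≠ 0 := by
  cases t <;> fin_cases i <;> fin_cases j <;> decide

theorem rootAction_alternatingWord_simpleRoot_nonneg (t : AffineType) (i j : Fin 3) (h : i ≠ j) :
    ∀ k < t.coxeterMatrix i j, ∀ l,
      0 ≤ t.rootAction (CoxeterSystem.alternatingWord i j k) (simpleRoot i) l := by
  cases t <;> fin_cases i <;> fin_cases j <;> first | contradiction | decide +kernel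

open CoxeterSystem in
theorem rootAction_alternatingWord_apply_of_ne (t : AffineType) {i j l : Fin 3} (hi : l ≠ i)
    (hj : l ≠ j) (k : ℕ) (p : Fin 3 → ℤ) :
    t.rootAction (alternatingWord i j k) p l = p l := by
  induction k generalizing i j p with
  | zero => rfl
  | succ k ih =>
    rw [alternatingWord_succ, List.concat_eq_append, rootAction_append, Module.End.mul_apply,
      ih hj hi, rootAction, List.map_singleton, List.prod_singleton,
      rootReflection_apply_of_ne t hj]

end AffineType

section RootRepresentation

open AffineType

variable {W : Type*} [Group W] {t : AffineType} (cs : CoxeterSystem t.coxeterMatrix W)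

/-- The action of `W` on the root lattice, in which the simple reflections act as the reflections
in the simple roots. -/
def rootRep : Representation ℤ W (Fin 3 → ℤ) :=
  cs.lift ⟨t.rootReflection, t.isLiftable_rootReflection⟩

variable {cs}

theorem rootRep_simple (i : Fin 3) : rootRep cs (cs.simple i) = t.rootReflection i :=
  cs.lift_apply_simple t.isLiftable_rootReflection i

theorem rootRep_wordProd (ω : List (Fin 3)) : rootRep cs (cs.wordProd ω) = t.rootAction ω := by
  rw [CoxeterSystem.wordProd, map_list_prod, List.map_map, rootAction]
  exact congrArg List.prod (List.map_congr_left fun i _ => rootRep_simple i)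

theorem rootRep_delta (w : W) : rootRep cs w t.delta = t.delta := by
  induction w using cs.simple_induction_left with
  | one => rw [map_one, Module.End.one_apply]
  | mul_simple_left w i ih =>
    rw [map_mul, Module.End.mul_apply, ih, rootRep_simple, rootReflection_delta]

theorem rootRep_apply_eq_sum (w : W) (p : Fin 3 → ℤ) :
    rootRep cs w p = ∑ i, p i • rootRep cs w (simpleRoot i) := by
  conv_lhs => rw [← Finset.univ_sum_single p]
  simp only [map_sum, ← map_smul, ← Pi.single_smul, smul_eq_mul, mul_one]

theorem rootRep_nonneg {w : W} {p : Fin 3 → ℤ} (hp : 0 ≤ p)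
    (h : ∀ i, p i ≠ 0 → 0 ≤ rootRep cs w (simpleRoot i)) : 0 ≤ rootRep cs w p := by
  rw [rootRep_apply_eq_sum]
  refine Finset.sum_nonneg fun i _ => ?_
  by_cases hi : p i = 0
  · rw [hi, zero_smul]
  · exact smul_nonneg (hp i) (h i hi)

open CoxeterSystem in
theorem rootRep_simpleRoot_nonneg {w : W} {i : Fin 3} (hi : ¬ cs.IsRightDescent w i) :
    0 ≤ rootRep cs w (simpleRoot i) := by
  induction hn : cs.length w using Nat.strong_induction_on generalizing w i with
  | _ n ih =>
  by_cases hw : w = 1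
  · rw [hw, map_one]
    exact simpleRoot_nonneg i
  obtain ⟨j, hj⟩ := cs.exists_rightDescent_of_ne_one hw
  have hij : i ≠ j := fun e => hi (e ▸ hj)
  obtain ⟨v, k, rfl, hlen, hvi, hvj⟩ := exists_eq_mul_wordProd_alternatingWord hi j
  have hk : k < t.coxeterMatrix i j :=
    lt_of_not_isRightDescent_mul_alternatingWord (t.coxeterMatrix_ne_zero i j) hlen hi
  have hk0 : k ≠ 0 := by
    rintro rfl
    rw [alternatingWord, cs.wordProd_nil, mul_one] at hj
    exact hvj hj
  rw [map_mul, Module.End.mul_apply, rootRep_wordProd]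
  refine rootRep_nonneg (t.rootAction_alternatingWord_simpleRoot_nonneg i j hij k hk) fun l hl => ?_
  by_cases hli : l = i
  · exact hli ▸ ih _ (by omega) hvi rfl
  by_cases hlj : l = j
  · exact hlj ▸ ih _ (by omega) hvj rfl
  · rw [rootAction_alternatingWord_apply_of_ne t hli hlj, simpleRoot, Pi.single_eq_of_ne hli] at hl
    exact absurd rfl hl

theorem rootRep_simpleRoot_nonpos {w : W} {i : Fin 3} (h : cs.IsRightDescent w i) :
    rootRep cs w (simpleRoot i) ≤ 0 := by
  have hpos := rootRep_simpleRoot_nonneg (cs.isRightDescent_iff_not_isRightDescent_mul.mp h)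
  rw [map_mul, Module.End.mul_apply, rootRep_simple, rootReflection_simpleRoot_self, map_neg]
    at hpos
  exact neg_nonneg.mp hpos

theorem not_isRightDescent_iff_rootRep_nonneg {w : W} {i : Fin 3} :
    ¬ cs.IsRightDescent w i ↔ 0 ≤ rootRep cs w (simpleRoot i) := by
  refine ⟨rootRep_simpleRoot_nonneg, fun h hd => ?_⟩
  have hzero : rootRep cs w (simpleRoot i) = 0 := le_antisymm (rootRep_simpleRoot_nonpos hd) h
  have hinj : simpleRoot i = 0 :=
    ((rootRep cs).apply_bijective w).injective (hzero.trans (map_zero _).symm)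
  exact one_ne_zero (Pi.single_eq_zero_iff.mp hinj)

theorem length_mul_simple_of_rootRep_nonneg {w : W} {i : Fin 3}
    (h : 0 ≤ rootRep cs w (simpleRoot i)) :
    cs.length (w * cs.simple i) = cs.length w + 1 :=
  cs.not_isRightDescent_iff.mp (not_isRightDescent_iff_rootRep_nonneg.mpr h)

theorem rootRep_injective : Function.Injective (rootRep cs) := by
  refine (injective_iff_map_eq_one _).mpr fun w hw =>
    eq_one_of_forall_not_isRightDescent (cs := cs) fun i => ?_
  rw [not_isRightDescent_iff_rootRep_nonneg, hw]
  exact simpleRoot_nonneg i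

theorem exists_not_isRightDescent (w : W) : ∃ i, ¬ cs.IsRightDescent w i := by
  by_contra! h
  have hδ : rootRep cs w t.delta ≤ 0 := by
    rw [rootRep_apply_eq_sum]
    exact Finset.sum_nonpos fun i _ =>
      smul_nonpos_of_nonneg_of_nonpos (t.delta_pos i).le (rootRep_simpleRoot_nonpos (h i))
  rw [rootRep_delta] at hδ
  exact (t.delta_pos 0).not_ge (hδ 0)

theorem rootRep_apply_of_mem_parabolic {I : Finset (Fin 3)} {v : W} (hv : v ∈ parabolic cs I)
    (p : Fin 3 → ℤ) {j : Fin 3} (hj : j ∉ I) : rootRep cs v p j = p j := by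
  induction hv using parabolic_induction with
  | one => rw [map_one, Module.End.one_apply]
  | simple_mul i hi w _ ih =>
    rw [map_mul, Module.End.mul_apply, rootRep_simple,
      rootReflection_apply_of_ne t (ne_of_mem_of_not_mem hi hj).symm, ih]

theorem length_mul_of_mem_minimalCosetReps {I : Finset (Fin 3)} {w v : W}
    (hw : w ∈ minimalCosetReps cs I) (hv : v ∈ parabolic cs I) :
    cs.length (w * v) = cs.length w + cs.length v := by
  induction hn : cs.length v generalizing v with
  | zero => rw [cs.length_eq_zero_iff.mp hn, mul_one, add_zero]
  | succ n ih =>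
    obtain ⟨j, hj⟩ : ∃ j, cs.IsRightDescent v j :=
      cs.exists_rightDescent_of_ne_one fun hv1 => by simp [hv1] at hn
    have hjI : j ∈ I := by
      by_contra hjI
      have h := rootRep_simpleRoot_nonpos hj j
      rw [rootRep_apply_of_mem_parabolic hv _ hjI, simpleRoot, Pi.single_eq_same] at h
      exact absurd h (by norm_num)
    have hv' : v * cs.simple j ∈ parabolic cs I := mul_mem hv (simple_mem_parabolic hjI)
    have hlen := cs.isRightDescent_iff.mp hj
    have hpos : 0 ≤ rootRep cs (w * (v * cs.simple j)) (simpleRoot j) := by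
      rw [map_mul, Module.End.mul_apply]
      refine rootRep_nonneg (rootRep_simpleRoot_nonneg
        (cs.isRightDescent_iff_not_isRightDescent_mul.mp hj)) fun i hi =>
          rootRep_simpleRoot_nonneg (hw i ?_)
      by_contra hiI
      rw [rootRep_apply_of_mem_parabolic hv' _ hiI] at hi
      exact hi (Pi.single_eq_of_ne (ne_of_mem_of_not_mem hjI hiI).symm _)
    have hmul := length_mul_simple_of_rootRep_nonneg hpos
    rw [mul_assoc, cs.simple_mul_simple_cancel_right, ih hv' (by omega)] at hmul
    omega

variable {k : Type*} [CommRing k] {q : k} {V : Type*} [AddCommGroup V] [Module k V]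

theorem poincareSeries_univ_mul_sum_inv (ρ : HeckeAlgebra cs q →ₐ[k] Module.End k V) :
    poincareSeries cs ρ Set.univ * ∑ I ∈ Finset.univ.erase (Finset.univ : Finset (Fin 3)),
      (-1 : ℤ) ^ I.card • ((parabolicUnit cs ρ I)⁻¹ : (PowerSeries (Module.End k V))ˣ).val = 1 := by
  have hnone : {w | ∀ i, cs.IsRightDescent w i} = ∅ :=
    Set.eq_empty_of_forall_notMem fun w hw =>
      let ⟨i, hi⟩ := exists_not_isRightDescent (cs := cs) w
      hi (hw i)
  have hsum := sum_neg_one_pow_smul_poincareSeries_minimalCosetReps ρ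
  rw [hnone, poincareSeries_empty, ← Finset.add_sum_erase _ _ (Finset.mem_univ Finset.univ),
    minimalCosetReps_univ, poincareSeries_singleton, poincareTerm_one] at hsum
  rw [Finset.mul_sum, Finset.sum_congr rfl fun I _ => ?_, ← neg_eq_iff_add_eq_zero.mpr hsum]
  · simp
  · rw [mul_smul_comm, ← poincareSeries_minimalCosetReps ρ fun _ hw _ hv =>
      length_mul_of_mem_minimalCosetReps hw hv]

end RootRepresentation

section Words

namespace AffineType

/-- The `n`-th root of the word `ω = i₀ i₁ ⋯`: the image of the simple root of the letter `iₙ`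
under the product of the reflections of the preceding letters. -/
def prefixRoot (t : AffineType) (ω : List (Fin 3)) (n : Fin ω.length) : Fin 3 → ℤ :=
  t.rootAction (ω.take n) (simpleRoot ω[n])

/-- All the roots of the word `ω` are nonnegative; this is a decidable criterion for `ω` to be
reduced. -/
abbrev IsPositiveWord (t : AffineType) (ω : List (Fin 3)) : Prop :=
  ∀ n l, 0 ≤ t.prefixRoot ω n l

/-- A decidable criterion for all the powers of the word `ω` to be reduced: the roots of `ω` and
their images under `ω` are nonnegative, and `ω²` shifts the roots of `ω` by nonnegative multiples
of `δ`. The bound on these multiples only makes the criterion decidable. -/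
structure IsStraightWord (t : AffineType) (ω : List (Fin 3)) : Prop where
  positive : t.IsPositiveWord ω
  apply_nonneg : ∀ n l, 0 ≤ t.rootAction ω (t.prefixRoot ω n) l
  sq_apply : ∀ n, ∃ c : Fin 10, t.rootAction (ω ++ ω) (t.prefixRoot ω n) =
    t.prefixRoot ω n + (c : ℤ) • t.delta

/-- A decidable criterion for `L` to be a list of reduced words for the elements of the parabolic
subgroup `W_I`, without repetitions. -/
structure IsParabolicList (t : AffineType) (I : Finset (Fin 3)) (L : List (List (Fin 3))) :
    Prop where
  nil_mem : [] ∈ L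
  letter_mem : ∀ ω ∈ L, ∀ i ∈ ω, i ∈ I
  positive : ∀ ω ∈ L, t.IsPositiveWord ω
  nodup : (L.map t.rootAction).Nodup
  cons_mem : ∀ i ∈ I, ∀ ω ∈ L, ∃ ω' ∈ L, t.rootAction (i :: ω) = t.rootAction ω'

end AffineType

open AffineType

variable {W : Type*} [Group W] {t : AffineType} {cs : CoxeterSystem t.coxeterMatrix W}

theorem length_mul_wordProd_of_prefixRoot {w : W} {ω : List (Fin 3)}
    (h : ∀ n, 0 ≤ rootRep cs w (t.prefixRoot ω n)) :
    cs.length (w * cs.wordProd ω) = cs.length w + ω.length := by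
  have hprefix : ∀ j ≤ ω.length,
      cs.length (w * cs.wordProd (ω.take j)) = cs.length w + j := by
    intro j
    induction j with
    | zero => simp
    | succ j ih =>
      intro hj
      have hpos : 0 ≤ rootRep cs (w * cs.wordProd (ω.take j)) (simpleRoot ω[j]) := by
        rw [map_mul, Module.End.mul_apply, rootRep_wordProd]
        exact h ⟨j, hj⟩
      rw [List.take_succ_eq_append_getElem hj, cs.wordProd_append, cs.wordProd_singleton,
        ← mul_assoc, length_mul_simple_of_rootRep_nonneg hpos, ih (by omega), add_assoc]
  simpa only [List.take_length] using hprefix ω.length le_rfl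

theorem isReduced_of_isPositiveWord {ω : List (Fin 3)} (h : t.IsPositiveWord ω) :
    cs.IsReduced ω := by
  have hlen := length_mul_wordProd_of_prefixRoot (cs := cs) (w := 1) (ω := ω) fun n => by
    rw [map_one]
    exact h n
  rwa [one_mul, cs.length_one, zero_add] at hlen

theorem isStraight_of_isStraightWord {ω : List (Fin 3)} (h : t.IsStraightWord ω) :
    IsStraight cs (cs.wordProd ω) := by
  have hroot (m : ℕ) (n : Fin ω.length) :
      0 ≤ rootRep cs (cs.wordProd ω ^ m) (t.prefixRoot ω n) := by
    induction m using Nat.twoStepInduction with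
    | zero =>
      rw [pow_zero, map_one]
      exact h.positive n
    | one =>
      rw [pow_one, rootRep_wordProd]
      exact h.apply_nonneg n
    | more m ih _ =>
      obtain ⟨c, hc⟩ := h.sq_apply n
      rw [pow_add, map_mul, Module.End.mul_apply, pow_two, ← cs.wordProd_append, rootRep_wordProd,
        hc, map_add, map_smul, rootRep_delta]
      exact add_nonneg ih (smul_nonneg (Int.natCast_nonneg _) fun i => (t.delta_pos i).le)
  intro n
  induction n with
  | zero => rw [pow_zero, cs.length_one, zero_mul]
  | succ n ih =>
    rw [pow_succ, length_mul_wordProd_of_prefixRoot (hroot n), ih, Nat.succ_mul,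
      (isReduced_of_isPositiveWord h.positive).eq]

theorem parabolic_eq_of_isParabolicList {I : Finset (Fin 3)} {L : List (List (Fin 3))}
    (h : t.IsParabolicList I L) :
    (parabolic cs I : Set W) = {w | w ∈ L.map cs.wordProd} := by
  ext w
  rw [Set.mem_ofPred_eq, List.mem_map]
  constructor
  · intro hw
    induction hw using parabolic_induction with
    | one => exact ⟨[], h.nil_mem, cs.wordProd_nil⟩
    | simple_mul i hi w _ ih =>
      obtain ⟨ω, hω, rfl⟩ := ih
      obtain ⟨ω', hω', heq⟩ := h.cons_mem i hi ω hω
      refine ⟨ω', hω', rootRep_injective (cs := cs) ?_⟩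
      rw [← cs.wordProd_cons, rootRep_wordProd, rootRep_wordProd, heq]
  · rintro ⟨ω, hω, rfl⟩
    refine Subgroup.list_prod_mem _ fun w hw => ?_
    obtain ⟨i, hi, rfl⟩ := List.mem_map.mp hw
    exact simple_mem_parabolic (h.letter_mem ω hω i hi)

variable {k : Type*} [CommRing k] {q : k} {V : Type*} [AddCommGroup V] [Module k V]
variable (ρ : HeckeAlgebra cs q →ₐ[k] Module.End k V)

theorem val_parabolicUnit_of_isParabolicList {I : Finset (Fin 3)} {L : List (List (Fin 3))}
    (h : t.IsParabolicList I L) :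
    (parabolicUnit cs ρ I : PowerSeries (Module.End k V)) =
      (L.map fun ω => (ω.map fun i => poincareTerm ρ (cs.simple i)).prod).sum := by
  have hnodup : (L.map cs.wordProd).Nodup := by
    refine List.Nodup.of_map (rootRep cs) ?_
    rw [List.map_map]
    exact (List.map_congr_left fun ω _ => rootRep_wordProd (cs := cs) ω).symm ▸ h.nodup
  rw [val_poincareUnit, parabolic_eq_of_isParabolicList h, poincareSeries_list ρ
    (fun ω hω => isReduced_of_isPositiveWord (h.positive ω hω)) hnodup]

end Words

namespace AffineType

open CoxeterSystem (alternatingWord)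

theorem isParabolicList_nil (t : AffineType) : t.IsParabolicList ∅ [[]] where
  nil_mem := List.mem_singleton_self _
  letter_mem := by decide
  positive := by cases t <;> decide
  nodup := List.nodup_singleton _
  cons_mem := fun _ hi => absurd hi (Finset.notMem_empty _)

theorem isParabolicList_singleton (t : AffineType) (i : Fin 3) :
    t.IsParabolicList {i} [[], [i]] := by
  constructor <;> cases t <;> decide +kernel +revert

/-- The alternating words in `i` and `j`, up to the length `m`: reduced words for the elements of
a dihedral group of order `2 * m`. -/
def dihedralWords (i j : Fin 3) (m : ℕ) : List (List (Fin 3)) :=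
  (List.range m).map (alternatingWord j i) ++
    (List.range m).map fun n => alternatingWord i j (n + 1)

theorem isParabolicList_pair (t : AffineType) {i j : Fin 3} (h : i ≠ j) :
    t.IsParabolicList {i, j} (dihedralWords i j (t.coxeterMatrix i j)) := by
  constructor <;> cases t <;> fin_cases i <;> fin_cases j <;>
    first | contradiction | decide +kernel

theorem isPositiveWord_alternatingWord (t : AffineType) {i j : Fin 3} (h : i ≠ j) :
    t.IsPositiveWord (alternatingWord i j (t.coxeterMatrix i j)) := by
  cases t <;> fin_cases i <;> fin_cases j <;> first | contradiction | decide +kernel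

/-- Words for the generators `w₁`, `w₂` of the stabilizers of the standard straight strips. -/
def stripWord : AffineType → Fin 2 → List (Fin 3)
  | A2 => ![[2, 1, 0], [2, 0, 1]]
  | C2 => ![[2, 0, 1, 0], [2, 0, 1]]
  | G2 => ![[2, 0, 1], [2, 0, 1, 0, 1]]

theorem isStraightWord_stripWord (t : AffineType) (i : Fin 2) :
    t.IsStraightWord (t.stripWord i) := by
  constructor <;> cases t <;> fin_cases i <;> decide +kernel

theorem rootAction_stripWord_ne_one (t : AffineType) (i : Fin 2) :
    t.rootAction (t.stripWord i) ≠ 1 := by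
  cases t <;> fin_cases i <;> decide +kernel

end AffineType

section Factorizations

open AffineType CoxeterSystem

variable {W : Type*} [Group W] {t : AffineType} {cs : CoxeterSystem t.coxeterMatrix W}
variable {k : Type*} [CommRing k] {q : k} {V : Type*} [AddCommGroup V] [Module k V]
variable (ρ : HeckeAlgebra cs q →ₐ[k] Module.End k V)

theorem parabolicUnit_empty : parabolicUnit cs ρ ∅ = 1 :=
  Units.ext <| (val_parabolicUnit_of_isParabolicList ρ t.isParabolicList_nil).trans (by simp)

theorem val_parabolicUnit_singleton (i : Fin 3) :
    (parabolicUnit cs ρ {i} : PowerSeries (Module.End k V)) =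
      1 + poincareTerm ρ (cs.simple i) :=
  (val_parabolicUnit_of_isParabolicList ρ (t.isParabolicList_singleton i)).trans (by simp)

theorem val_parabolicUnit_pair {i j : Fin 3} {m : ℕ} (h : i ≠ j) (hm : t.coxeterMatrix i j = m) :
    (parabolicUnit cs ρ {i, j} : PowerSeries (Module.End k V)) =
      ((dihedralWords i j m).map fun ω =>
        (ω.map fun l => poincareTerm ρ (cs.simple l)).prod).sum :=
  hm ▸ val_parabolicUnit_of_isParabolicList ρ (t.isParabolicList_pair h)

theorem prod_poincareTerm_alternatingWord {i j : Fin 3} {m : ℕ} (h : i ≠ j)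
    (hm : t.coxeterMatrix i j = m) :
    ((alternatingWord i j m).map fun l => poincareTerm ρ (cs.simple l)).prod =
      ((alternatingWord j i m).map fun l => poincareTerm ρ (cs.simple l)).prod := by
  subst hm
  have hsymm := t.coxeterMatrix.symmetric j i
  have hbraid := cs.wordProd_braidWord_eq i j
  rw [braidWord, braidWord, hsymm] at hbraid
  rw [← poincareTerm_wordProd ρ (isReduced_of_isPositiveWord (t.isPositiveWord_alternatingWord h)),
    hbraid, poincareTerm_wordProd]
  exact hsymm ▸ isReduced_of_isPositiveWord (t.isPositiveWord_alternatingWord h.symm)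

theorem val_inv_poincareUnit_powers_stripWord (i : Fin 2) :
    ((poincareUnit cs ρ (Submonoid.powers (cs.wordProd (t.stripWord i))) (one_mem _))⁻¹ :
      (PowerSeries (Module.End k V))ˣ) =
      1 - ((t.stripWord i).map fun l => poincareTerm ρ (cs.simple l)).prod := by
  have hne : cs.wordProd (t.stripWord i) ≠ 1 := fun h => t.rootAction_stripWord_ne_one i <| by
    rw [← rootRep_wordProd (cs := cs), h, map_one]
  have hstraight := t.isStraightWord_stripWord i
  rw [val_inv_poincareUnit_powers ρ hne (isStraight_of_isStraightWord hstraight),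
    poincareTerm_wordProd ρ (isReduced_of_isPositiveWord hstraight.positive)]

theorem poincareSeries_univ_mul_alternating_sum :
    poincareSeries cs ρ Set.univ *
      (1 - ↑(parabolicUnit cs ρ {0})⁻¹ - ↑(parabolicUnit cs ρ {1})⁻¹ - ↑(parabolicUnit cs ρ {2})⁻¹ +
        ↑(parabolicUnit cs ρ {1, 2})⁻¹ + ↑(parabolicUnit cs ρ {0, 2})⁻¹ +
        ↑(parabolicUnit cs ρ {0, 1})⁻¹) = 1 := by
  have hproper : Finset.univ.erase (Finset.univ : Finset (Fin 3)) =
      {∅, {0}, {1}, {2}, {1, 2}, {0, 2}, {0, 1}} := by decide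
  refine (congrArg _ ?_).trans (poincareSeries_univ_mul_sum_inv ρ)
  rw [hproper]
  repeat rw [Finset.sum_insert (by decide)]
  simp [parabolicUnit_empty, sub_eq_add_neg, add_assoc]

end Factorizations

section RingIdentities

variable {R : Type*} [Ring R]

theorem alternating_identity_A2 {x y z : R} (hxy : y * x * y = x * y * x)
    (hxz : z * x * z = x * z * x) :
    (1 + x + z + x * z + z * x + x * z * x) * (1 + x + y + x * y + y * x + x * y * x) -
        (1 + x + z + x * z + z * x + x * z * x) * (1 + y + y * x) -
        (1 + x + z + x * z + z * x + x * z * x) * (1 + x + x * y) -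
        (1 + x + z * x) * (1 + x + y + x * y + y * x + x * y * x) +
        (1 + x + y + x * y + y * x + x * y * x) + (1 + x + z + x * z + z * x + x * z * x) =
      -((1 + x + z * x) * x * (1 + y)) - z * x * ((1 - z * y * x) * (1 + y)) := by
  simp only [mul_assoc] at hxy hxz
  have hxz' : ∀ r, z * (x * (z * r)) = x * (z * (x * r)) := fun r => by
    simpa only [mul_assoc] using congrArg (· * r) hxz
  simp only [mul_add, add_mul, mul_sub, sub_mul, mul_one, one_mul, mul_assoc, hxy, hxz']
  abel

theorem alternating_identity_C2 {x y z : R} (hxy : x * y * x * y = y * x * y * x)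
    (hyz : z * y = y * z) :
    (1 + x) * (1 - z * x * y) * (1 - z * x * y * x) =
      (1 + x + z * x + x * z * x) * z * y * (1 + x + x * y + x * y * x) -
      (1 + x + z * x + x * z * x) * (1 + z) * (1 + y + y * x + y * x * y) +
      (1 + x) * (1 + y + y * x + y * x * y) + (1 + x + z * x + x * z * x) * (1 + z) := by
  simp only [mul_assoc] at hxy hyz
  have hyz' : ∀ r, z * (y * r) = y * (z * r) := fun r => by
    rw [← mul_assoc, hyz, mul_assoc]
  simp only [mul_add, add_mul, mul_sub, sub_mul, mul_one, one_mul, mul_assoc, hxy, hyz, hyz']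
  abel

theorem alternating_identity_G2 {x y z : R} (hxy : x * y * x * y * x * y = y * x * y * x * y * x)
    (hxz : z * x * z = x * z * x) (hyz : z * y = y * z) :
    (1 - z * x * y) * (1 - z * x * y * x * y) * (1 + x) =
      (1 + x + z * x) * z * y * (1 + x + x * y + x * y * x + x * y * x * y + x * y * x * y * x) -
      (1 + x + z * x) * (1 + z) *
        (1 + y + y * x + y * x * y + y * x * y * x + y * x * y * x * y) +
      (1 + x) * (1 + y + y * x + y * x * y + y * x * y * x + y * x * y * x * y) +
        (1 + x + z * x) * (1 + z) := by
  simp only [mul_assoc] at hxy hxz hyz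
  have hxy' : ∀ r, x * (y * (x * (y * (x * (y * r))))) = y * (x * (y * (x * (y * (x * r))))) :=
    fun r => by simpa only [mul_assoc] using congrArg (· * r) hxy
  have hxz' : ∀ r, z * (x * (z * r)) = x * (z * (x * r)) := fun r => by
    simpa only [mul_assoc] using congrArg (· * r) hxz
  have hyz' : ∀ r, z * (y * r) = y * (z * r) := fun r => by
    rw [← mul_assoc, hyz, mul_assoc]
  have hxyz : ∀ r, z * (x * (y * (z * r))) = x * (z * (x * (y * r))) := fun r => by
    rw [← hyz', hxz']
  simp only [mul_add, add_mul, mul_sub, sub_mul, mul_one, one_mul, mul_assoc, hxy, hxz, hyz, hxy',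
    hyz', hxyz]
  abel

variable {u₁ u₂ u₃ u₁₂ u₁₃ u₂₃ g₁ g₂ : Rˣ} {x y z p r s W : R}

theorem eq_val_of_mul_eq_one {m : R} {X : Rˣ} (hW : W * m = 1)
    (h : (u₁₃ : R) * m * u₁₂ = X) : W = ↑(u₁₂ * X⁻¹ * u₁₃) := by
  have hm : m = ↑(u₁₃⁻¹ * X * u₁₂⁻¹) := by
    rw [Units.val_mul, Units.val_mul, ← h, mul_assoc, mul_assoc, Units.mul_inv, mul_one,
      Units.inv_mul_cancel_left]
  rw [hm, Units.mul_eq_one_iff_eq_inv] at hW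
  rw [hW, mul_inv_rev, mul_inv_rev, inv_inv, inv_inv, mul_assoc]

theorem mul_alternating_mul (hp : (u₁₃ : R) = p * u₃) (hr : (u₁₂ : R) = u₂ * r)
    (hs : (u₁₂ : R) = u₁ * s) :
    (u₁₃ : R) * (1 - ↑u₁⁻¹ - ↑u₂⁻¹ - ↑u₃⁻¹ + ↑u₂₃⁻¹ + ↑u₁₃⁻¹ + ↑u₁₂⁻¹) * u₁₂ =
      u₁₃ * u₁₂ - u₁₃ * s - u₁₃ * r - p * u₁₂ + u₁₃ * ↑u₂₃⁻¹ * u₁₂ + u₁₂ + u₁₃ := by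
  have hs' : (u₁⁻¹ : Rˣ) * (u₁₂ : R) = s := (Units.inv_mul_eq_iff_eq_mul _).mpr hs
  have hr' : (u₂⁻¹ : Rˣ) * (u₁₂ : R) = r := (Units.inv_mul_eq_iff_eq_mul _).mpr hr
  have hp' : (u₁₃ : R) * (u₃⁻¹ : Rˣ) = p := (Units.mul_inv_eq_iff_eq_mul _).mpr hp
  calc
    _ = (u₁₃ : R) * u₁₂ - u₁₃ * (↑u₁⁻¹ * u₁₂) - u₁₃ * (↑u₂⁻¹ * u₁₂) - u₁₃ * ↑u₃⁻¹ * u₁₂ +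
          u₁₃ * ↑u₂₃⁻¹ * u₁₂ + u₁₃ * ↑u₁₃⁻¹ * u₁₂ + u₁₃ * (↑u₁₂⁻¹ * u₁₂) := by noncomm_ring
    _ = _ := by rw [hs', hr', hp', u₁₃.mul_inv, u₁₂.inv_mul, one_mul, mul_one]

theorem mul_alternating_mul_of_eq_mul (hy : (u₂ : R) = 1 + y) (hz : (u₃ : R) = 1 + z)
    (hyz : u₂₃ = u₂ * u₃) (hp : (u₁₃ : R) = p * u₃) (hr : (u₁₂ : R) = u₂ * r)
    (hs : (u₁₂ : R) = u₁ * s) :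
    (u₁₃ : R) * (1 - ↑u₁⁻¹ - ↑u₂⁻¹ - ↑u₃⁻¹ + ↑u₂₃⁻¹ + ↑u₁₃⁻¹ + ↑u₁₂⁻¹) * u₁₂ =
      p * z * y * r - u₁₃ * s + u₁₂ + u₁₃ := by
  have hpr : (u₁₃ : R) * ↑u₂₃⁻¹ * u₁₂ = p * r := by
    rw [hp, hr, hyz, mul_inv_rev, Units.val_mul]
    simp only [mul_assoc, Units.mul_inv_cancel_left, Units.inv_mul_cancel_left]
  rw [mul_alternating_mul hp hr hs, hpr, hp, hr, hy, hz]
  noncomm_ring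

theorem strip_identity_A2 (hxy : y * x * y = x * y * x) (hxz : z * x * z = x * z * x)
    (hx : (u₁ : R) = 1 + x) (hy : (u₂ : R) = 1 + y) (hz : (u₃ : R) = 1 + z)
    (h₁₂ : (u₁₂ : R) = 1 + x + y + x * y + y * x + y * x * y)
    (h₁₃ : (u₁₃ : R) = 1 + x + z + x * z + z * x + z * x * z)
    (h₂₃ : (u₂₃ : R) = 1 + y + z + y * z + z * y + z * y * z) :
    (u₁ : R) * (1 - z * x * y) * u₃ * ↑u₂₃⁻¹ * (1 - z * y * x) * u₂ =
      u₁₃ * ↑u₂₃⁻¹ * u₁₂ - (1 + x + z * x) * x * u₂ - z * x * ((1 - z * y * x) * u₂) := by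
  have hleft : (u₁ : R) * (1 - z * x * y) * u₃ = u₁₃ - z * x * u₂₃ := by
    rw [hx, hz, h₁₃, h₂₃]
    simp only [mul_add, add_mul, mul_sub, sub_mul, mul_one, one_mul, ← mul_assoc, hxz]
    abel
  have hright : (1 - z * y * x) * u₂ = u₁₂ - (1 + y + z * y) * x * u₂ := by
    rw [hy, h₁₂]
    simp only [mul_add, add_mul, sub_mul, mul_one, one_mul, hxy]
    abel
  have h₃ : (u₂₃⁻¹ : Rˣ) * (1 + y + z * y) = (u₃⁻¹ : Rˣ) := by
    rw [Units.inv_mul_eq_iff_eq_mul, Units.eq_mul_inv_iff_mul_eq, hz, h₂₃]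
    noncomm_ring
  have hp : (u₁₃ : R) * (u₃⁻¹ : Rˣ) = 1 + x + z * x := by
    rw [Units.mul_inv_eq_iff_eq_mul, hz, h₁₃]
    noncomm_ring
  calc
    _ = u₁₃ * ↑u₂₃⁻¹ * ((1 - z * y * x) * u₂) -
          z * x * (u₂₃ * ↑u₂₃⁻¹) * ((1 - z * y * x) * u₂) := by rw [hleft]; noncomm_ring
    _ = u₁₃ * ↑u₂₃⁻¹ * u₁₂ - u₁₃ * (↑u₂₃⁻¹ * (1 + y + z * y)) * x * u₂ -
          z * x * ((1 - z * y * x) * u₂) := by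
      rw [u₂₃.mul_inv]
      nth_rewrite 1 [hright]
      noncomm_ring
    _ = _ := by rw [h₃, hp]

theorem eq_prod_A2 (hxy : y * x * y = x * y * x) (hxz : z * x * z = x * z * x)
    (hx : (u₁ : R) = 1 + x) (hy : (u₂ : R) = 1 + y) (hz : (u₃ : R) = 1 + z)
    (h₁₂ : (u₁₂ : R) = 1 + x + y + x * y + y * x + y * x * y)
    (h₁₃ : (u₁₃ : R) = 1 + x + z + x * z + z * x + z * x * z)
    (h₂₃ : (u₂₃ : R) = 1 + y + z + y * z + z * y + z * y * z)
    (hg₁ : (↑g₁⁻¹ : R) = 1 - z * y * x) (hg₂ : (↑g₂⁻¹ : R) = 1 - z * x * y)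
    (hW : W * (1 - ↑u₁⁻¹ - ↑u₂⁻¹ - ↑u₃⁻¹ + ↑u₂₃⁻¹ + ↑u₁₃⁻¹ + ↑u₁₂⁻¹) = 1) :
    W = ↑(u₁₂ * (u₁ * g₂⁻¹ * u₃ * u₂₃⁻¹ * g₁⁻¹ * u₂)⁻¹ * u₁₃) := by
  have hp : (u₁₃ : R) = (1 + x + z * x) * u₃ := by
    rw [h₁₃, hz]
    noncomm_ring
  have hr : (u₁₂ : R) = u₂ * (1 + x + x * y) := by
    rw [h₁₂, hy]
    noncomm_ring
  have hs : (u₁₂ : R) = u₁ * (1 + y + y * x) := by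
    rw [h₁₂, hx, hxy]
    noncomm_ring
  refine eq_val_of_mul_eq_one hW ?_
  simp only [Units.val_mul, hg₁, hg₂]
  rw [strip_identity_A2 hxy hxz hx hy hz h₁₂ h₁₃ h₂₃, mul_alternating_mul hp hr hs, h₁₂, h₁₃,
    hy, hxy, hxz]
  linear_combination (norm := abel) alternating_identity_A2 hxy hxz

theorem eq_prod_C2 (hxy : x * y * x * y = y * x * y * x) (hyz : z * y = y * z)
    (hx : (u₁ : R) = 1 + x) (hy : (u₂ : R) = 1 + y) (hz : (u₃ : R) = 1 + z)
    (h₁₂ : (u₁₂ : R) = (1 + x) * (1 + y + y * x + y * x * y))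
    (h₁₃ : (u₁₃ : R) = (1 + x + z * x + x * z * x) * (1 + z)) (h₂₃ : u₂₃ = u₂ * u₃)
    (hg₁ : (↑g₁⁻¹ : R) = 1 - z * x * y * x) (hg₂ : (↑g₂⁻¹ : R) = 1 - z * x * y)
    (hW : W * (1 - ↑u₁⁻¹ - ↑u₂⁻¹ - ↑u₃⁻¹ + ↑u₂₃⁻¹ + ↑u₁₃⁻¹ + ↑u₁₂⁻¹) = 1) :
    W = ↑(u₁₂ * (u₁ * g₂⁻¹ * g₁⁻¹)⁻¹ * u₁₃) := by
  have hr : (u₁₂ : R) = u₂ * (1 + x + x * y + x * y * x) := by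
    rw [h₁₂, hy]
    simp only [mul_add, add_mul, mul_one, one_mul, ← mul_assoc, hxy]
    abel
  refine eq_val_of_mul_eq_one hW ?_
  rw [mul_alternating_mul_of_eq_mul hy hz h₂₃ (hz ▸ h₁₃) hr (hx ▸ h₁₂), h₁₂, h₁₃,
    ← alternating_identity_C2 hxy hyz]
  simp only [Units.val_mul, hx, hg₁, hg₂]

theorem eq_prod_G2 (hxy : x * y * x * y * x * y = y * x * y * x * y * x)
    (hxz : z * x * z = x * z * x) (hyz : z * y = y * z)
    (hx : (u₁ : R) = 1 + x) (hy : (u₂ : R) = 1 + y) (hz : (u₃ : R) = 1 + z)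
    (h₁₂ : (u₁₂ : R) =
      (1 + x) * (1 + y + y * x + y * x * y + y * x * y * x + y * x * y * x * y))
    (h₁₃ : (u₁₃ : R) = (1 + x + z * x) * (1 + z)) (h₂₃ : u₂₃ = u₂ * u₃)
    (hg₁ : (↑g₁⁻¹ : R) = 1 - z * x * y) (hg₂ : (↑g₂⁻¹ : R) = 1 - z * x * y * x * y)
    (hW : W * (1 - ↑u₁⁻¹ - ↑u₂⁻¹ - ↑u₃⁻¹ + ↑u₂₃⁻¹ + ↑u₁₃⁻¹ + ↑u₁₂⁻¹) = 1) :
    W = ↑(u₁₂ * (g₁⁻¹ * g₂⁻¹ * u₁)⁻¹ * u₁₃) := by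
  have hr : (u₁₂ : R) =
      u₂ * (1 + x + x * y + x * y * x + x * y * x * y + x * y * x * y * x) := by
    rw [h₁₂, hy]
    simp only [mul_add, add_mul, mul_one, one_mul, ← mul_assoc, hxy]
    abel
  refine eq_val_of_mul_eq_one hW ?_
  rw [mul_alternating_mul_of_eq_mul hy hz h₂₃ (hz ▸ h₁₃) hr (hx ▸ h₁₂), h₁₂, h₁₃,
    ← alternating_identity_G2 hxy hxz hyz]
  simp only [Units.val_mul, hx, hg₁, hg₂]

end RingIdentities

section Orderings

open AffineType CoxeterSystem

variable {W : Type*} [Group W] {t : AffineType} {cs : CoxeterSystem t.coxeterMatrix W}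
variable {k : Type*} [CommRing k] {q : k} {V : Type*} [AddCommGroup V] [Module k V]
variable (ρ : HeckeAlgebra cs q →ₐ[k] Module.End k V) {i j : Fin 3}

theorem poincareTerm_commute_of_eq_two (h : i ≠ j) (hm : t.coxeterMatrix i j = 2) :
    poincareTerm ρ (cs.simple j) * poincareTerm ρ (cs.simple i) =
      poincareTerm ρ (cs.simple i) * poincareTerm ρ (cs.simple j) := by
  simpa [alternatingWord] using (prod_poincareTerm_alternatingWord ρ h hm).symm

theorem poincareTerm_braid_of_eq_three {x y : PowerSeries (Module.End k V)} (h : i ≠ j)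
    (hm : t.coxeterMatrix i j = 3) (hx : poincareTerm ρ (cs.simple i) = x)
    (hy : poincareTerm ρ (cs.simple j) = y) : y * x * y = x * y * x := by
  simpa [alternatingWord, hx, hy, mul_assoc] using prod_poincareTerm_alternatingWord ρ h hm

theorem poincareTerm_braid_of_eq_four {x y : PowerSeries (Module.End k V)} (h : i ≠ j)
    (hm : t.coxeterMatrix i j = 4) (hx : poincareTerm ρ (cs.simple i) = x)
    (hy : poincareTerm ρ (cs.simple j) = y) : x * y * x * y = y * x * y * x := by
  simpa [alternatingWord, hx, hy, mul_assoc] using prod_poincareTerm_alternatingWord ρ h hm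

theorem poincareTerm_braid_of_eq_six {x y : PowerSeries (Module.End k V)} (h : i ≠ j)
    (hm : t.coxeterMatrix i j = 6) (hx : poincareTerm ρ (cs.simple i) = x)
    (hy : poincareTerm ρ (cs.simple j) = y) :
    x * y * x * y * x * y = y * x * y * x * y * x := by
  simpa [alternatingWord, hx, hy, mul_assoc] using prod_poincareTerm_alternatingWord ρ h hm

theorem parabolicUnit_pair_of_eq_two (h : i ≠ j) (hm : t.coxeterMatrix i j = 2) :
    parabolicUnit cs ρ {i, j} = parabolicUnit cs ρ {i} * parabolicUnit cs ρ {j} := by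
  ext1
  rw [Units.val_mul, val_parabolicUnit_pair ρ h hm, val_parabolicUnit_singleton,
    val_parabolicUnit_singleton]
  simp only [dihedralWords, List.range_succ, List.range_zero, List.nil_append, List.cons_append,
    List.map_cons, List.map_nil, alternatingWord, List.concat_eq_append, List.prod_nil,
    List.prod_cons, List.sum_cons, List.sum_nil]
  noncomm_ring

theorem val_parabolicUnit_pair_of_eq_three {x y : PowerSeries (Module.End k V)} (h : i ≠ j)
    (hm : t.coxeterMatrix i j = 3) (hx : poincareTerm ρ (cs.simple i) = x)
    (hy : poincareTerm ρ (cs.simple j) = y) :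
    (parabolicUnit cs ρ {i, j} : PowerSeries (Module.End k V)) =
      1 + x + y + x * y + y * x + y * x * y := by
  rw [val_parabolicUnit_pair ρ h hm]
  simp only [dihedralWords, List.range_succ, List.range_zero, List.nil_append, List.cons_append,
    List.map_cons, List.map_nil, alternatingWord, List.concat_eq_append, List.prod_nil,
    List.prod_cons, List.sum_cons, List.sum_nil, hx, hy]
  noncomm_ring

theorem val_parabolicUnit_pair_of_eq_four {x y : PowerSeries (Module.End k V)} (h : i ≠ j)
    (hm : t.coxeterMatrix i j = 4) (hx : poincareTerm ρ (cs.simple i) = x)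
    (hy : poincareTerm ρ (cs.simple j) = y) :
    (parabolicUnit cs ρ {i, j} : PowerSeries (Module.End k V)) =
      (1 + x) * (1 + y + y * x + y * x * y) := by
  rw [val_parabolicUnit_pair ρ h hm]
  simp only [dihedralWords, List.range_succ, List.range_zero, List.nil_append, List.cons_append,
    List.map_cons, List.map_nil, alternatingWord, List.concat_eq_append, List.prod_nil,
    List.prod_cons, List.sum_cons, List.sum_nil, hx, hy]
  noncomm_ring

theorem val_parabolicUnit_pair_of_eq_six {x y : PowerSeries (Module.End k V)} (h : i ≠ j)
    (hm : t.coxeterMatrix i j = 6) (hx : poincareTerm ρ (cs.simple i) = x)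
    (hy : poincareTerm ρ (cs.simple j) = y) :
    (parabolicUnit cs ρ {i, j} : PowerSeries (Module.End k V)) =
      (1 + x) * (1 + y + y * x + y * x * y + y * x * y * x + y * x * y * x * y) := by
  rw [val_parabolicUnit_pair ρ h hm]
  simp only [dihedralWords, List.range_succ, List.range_zero, List.nil_append, List.cons_append,
    List.map_cons, List.map_nil, alternatingWord, List.concat_eq_append, List.prod_nil,
    List.prod_cons, List.sum_cons, List.sum_nil, hx, hy]
  noncomm_ring

/-- The label of the factor `W_I(ρ, u) ^ ((-1) ^ |I|)`. -/
abbrev parabolicLabel (I : Finset (Fin 3)) (h : I ≠ Finset.univ := by decide) : FactorLabel :=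
  .inr ⟨I, h⟩

theorem forall_mem_of_nodup {l : List FactorLabel} (h : l.Nodup) (hl : l.length = 9)
    (x : FactorLabel) : x ∈ l := by
  have huniv : l.toFinset = Finset.univ := Finset.eq_univ_of_card _ <| by
    rw [List.toFinset_card_of_nodup h, hl]
    decide +kernel
  exact List.mem_toFinset.mp (huniv ▸ Finset.mem_univ x)

variable (cs) in
/-- For some ordering of the factors built from the words of `stripWord`, their product is
`W(ρ, u)`. -/
def HasFactorization : Prop :=
  ∃ l : List FactorLabel, l.Nodup ∧ (∀ x, x ∈ l) ∧
    ((l.map (factor cs ρ fun i => cs.wordProd (t.stripWord i))).prod :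
      PowerSeries (Module.End k V)) = poincareSeries cs ρ Set.univ

theorem hasFactorization_A2 {cs : CoxeterSystem A2.coxeterMatrix W}
    (ρ : HeckeAlgebra cs q →ₐ[k] Module.End k V) : HasFactorization cs ρ := by
  refine ⟨[parabolicLabel ∅, parabolicLabel {0, 1}, parabolicLabel {1}, .inl 0,
    parabolicLabel {1, 2}, parabolicLabel {2}, .inl 1, parabolicLabel {0}, parabolicLabel {0, 2}],
    by decide, forall_mem_of_nodup (by decide) rfl, ?_⟩
  have hg₁ := val_inv_poincareUnit_powers_stripWord ρ 0
  have hg₂ := val_inv_poincareUnit_powers_stripWord ρ 1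
  simp only [stripWord, Matrix.cons_val_zero, Matrix.cons_val_one, List.map_cons, List.map_nil,
    List.prod_cons, List.prod_nil, mul_one, ← mul_assoc] at hg₁ hg₂
  rw [eq_prod_A2 (poincareTerm_braid_of_eq_three ρ (by decide) rfl rfl rfl)
    (poincareTerm_braid_of_eq_three ρ (by decide) rfl rfl rfl)
    (val_parabolicUnit_singleton ρ 0) (val_parabolicUnit_singleton ρ 1)
    (val_parabolicUnit_singleton ρ 2)
    (val_parabolicUnit_pair_of_eq_three ρ (by decide) rfl rfl rfl)
    (val_parabolicUnit_pair_of_eq_three ρ (by decide) rfl rfl rfl)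
    (val_parabolicUnit_pair_of_eq_three ρ (by decide) rfl rfl rfl)
    hg₁ hg₂ (poincareSeries_univ_mul_alternating_sum ρ)]
  simp [factor, stripWord, parabolicUnit_empty, mul_assoc]

theorem hasFactorization_C2 {cs : CoxeterSystem C2.coxeterMatrix W}
    (ρ : HeckeAlgebra cs q →ₐ[k] Module.End k V) : HasFactorization cs ρ := by
  refine ⟨[parabolicLabel ∅, parabolicLabel {2}, parabolicLabel {1}, parabolicLabel {1, 2},
    parabolicLabel {0, 1}, .inl 0, .inl 1, parabolicLabel {0}, parabolicLabel {0, 2}],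
    by decide, forall_mem_of_nodup (by decide) rfl, ?_⟩
  have hyz := poincareTerm_commute_of_eq_two ρ (i := 1) (j := 2) (by decide) rfl
  have h₁₃ := val_parabolicUnit_pair_of_eq_four ρ (i := 0) (j := 2) (by decide) rfl rfl rfl
  have h₂₃ := parabolicUnit_pair_of_eq_two ρ (i := 1) (j := 2) (by decide) rfl
  have hg₁ := val_inv_poincareUnit_powers_stripWord ρ 0
  have hg₂ := val_inv_poincareUnit_powers_stripWord ρ 1
  simp only [stripWord, Matrix.cons_val_zero, Matrix.cons_val_one, List.map_cons, List.map_nil,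
    List.prod_cons, List.prod_nil, mul_one, ← mul_assoc] at hg₁ hg₂
  rw [eq_prod_C2 (poincareTerm_braid_of_eq_four ρ (by decide) rfl rfl rfl) hyz
    (val_parabolicUnit_singleton ρ 0) (val_parabolicUnit_singleton ρ 1)
    (val_parabolicUnit_singleton ρ 2)
    (val_parabolicUnit_pair_of_eq_four ρ (by decide) rfl rfl rfl)
    (h₁₃.trans (by noncomm_ring)) h₂₃
    hg₁ hg₂ (poincareSeries_univ_mul_alternating_sum ρ)]
  simp [factor, stripWord, parabolicUnit_empty, mul_assoc, h₂₃]

theorem hasFactorization_G2 {cs : CoxeterSystem G2.coxeterMatrix W}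
    (ρ : HeckeAlgebra cs q →ₐ[k] Module.End k V) : HasFactorization cs ρ := by
  refine ⟨[parabolicLabel ∅, parabolicLabel {2}, parabolicLabel {1}, parabolicLabel {1, 2},
    parabolicLabel {0, 1}, parabolicLabel {0}, .inl 1, .inl 0, parabolicLabel {0, 2}],
    by decide, forall_mem_of_nodup (by decide) rfl, ?_⟩
  have hyz := poincareTerm_commute_of_eq_two ρ (i := 1) (j := 2) (by decide) rfl
  have h₁₃ := val_parabolicUnit_pair_of_eq_three ρ (i := 0) (j := 2) (by decide) rfl rfl rfl
  have h₂₃ := parabolicUnit_pair_of_eq_two ρ (i := 1) (j := 2) (by decide) rfl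
  have hg₁ := val_inv_poincareUnit_powers_stripWord ρ 0
  have hg₂ := val_inv_poincareUnit_powers_stripWord ρ 1
  simp only [stripWord, Matrix.cons_val_zero, Matrix.cons_val_one, List.map_cons, List.map_nil,
    List.prod_cons, List.prod_nil, mul_one, ← mul_assoc] at hg₁ hg₂
  rw [eq_prod_G2 (poincareTerm_braid_of_eq_six ρ (by decide) rfl rfl rfl)
    (poincareTerm_braid_of_eq_three ρ (by decide) rfl rfl rfl) hyz
    (val_parabolicUnit_singleton ρ 0) (val_parabolicUnit_singleton ρ 1)
    (val_parabolicUnit_singleton ρ 2)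
    (val_parabolicUnit_pair_of_eq_six ρ (by decide) rfl rfl rfl)
    (h₁₃.trans (by noncomm_ring)) h₂₃
    hg₁ hg₂ (poincareSeries_univ_mul_alternating_sum ρ)]
  simp [factor, stripWord, parabolicUnit_empty, mul_assoc, h₂₃]

theorem hasFactorization : HasFactorization cs ρ := by
  cases t
  · exact hasFactorization_A2 ρ
  · exact hasFactorization_C2 ρ
  · exact hasFactorization_G2 ρ

end Orderings

namespace AffineType

theorem affineIndependent_vertex (t : AffineType) : AffineIndependent ℝ t.vertex := by
  have him : (t.vertex 0).im ≠ 0 := by cases t <;> simp [vertex]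
  have hv : t.vertex 1 = 1 ∧ t.vertex 2 = 0 := by cases t <;> simp [vertex]
  have hpair : (fun i : {i : Fin 3 // i ≠ 2} => t.vertex i -ᵥ t.vertex 2) ∘ finSuccAboveEquiv 2 =
      ![t.vertex 0, 1] := by
    ext i : 1
    fin_cases i
    · exact (congrArg _ hv.2).trans (sub_zero _)
    · exact (congrArg₂ _ hv.1 hv.2).trans (sub_zero _)
  rw [affineIndependent_iff_linearIndependent_vsub ℝ _ (2 : Fin 3),
    ← linearIndependent_equiv (finSuccAboveEquiv (2 : Fin 3)), hpair, LinearIndependent.pair_iff]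
  intro a b hab
  have ha : a = 0 := by simpa [him] using congrArg Complex.im hab
  exact ⟨ha, by simpa [ha] using hab⟩

/-- The vertices of the fundamental chamber, as an affine basis of the plane. -/
def vertexBasis (t : AffineType) : AffineBasis (Fin 3) ℝ ℂ where
  toFun := t.vertex
  ind' := t.affineIndependent_vertex
  tot' := t.affineIndependent_vertex.affineSpan_eq_top_iff_card_eq_finrank_add_one.mpr (by simp)

theorem vertexBasis_apply (t : AffineType) (k : Fin 3) : t.vertexBasis k = t.vertex k := rfl

/-- The affine function on the plane that is given by an element of the root lattice. The simple
root `αₖ` vanishes on the `k`-th side of the fundamental chamber and is positive on the chamber;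
`δ` is the constant function `1`. -/
def affineRoot (t : AffineType) : (Fin 3 → ℤ) →ₗ[ℤ] (ℂ →ᵃ[ℝ] ℝ) :=
  Fintype.linearCombination ℤ fun k => (t.delta k : ℝ)⁻¹ • t.vertexBasis.coord k

theorem affineRoot_simpleRoot (t : AffineType) (k : Fin 3) (z : ℂ) :
    t.affineRoot (simpleRoot k) z = (t.delta k : ℝ)⁻¹ * t.vertexBasis.coord k z := by
  simp [affineRoot]

theorem cast_delta_pos (t : AffineType) (k : Fin 3) : (0 : ℝ) < t.delta k :=
  Int.cast_pos.mpr (t.delta_pos k)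

theorem affineRoot_apply (t : AffineType) (p : Fin 3 → ℤ) (z : ℂ) :
    t.affineRoot p z = ∑ k, p k * ((t.delta k : ℝ)⁻¹ * t.vertexBasis.coord k z) := by
  simp [affineRoot, Fintype.linearCombination_apply, Fin.sum_univ_three, mul_left_comm]

theorem affineRoot_delta (t : AffineType) (z : ℂ) : t.affineRoot t.delta z = 1 := by
  simp [affineRoot_apply, mul_inv_cancel_left₀ (t.cast_delta_pos _).ne']

theorem affineRoot_add_smul_delta (t : AffineType) (p : Fin 3 → ℤ) (m : ℤ) (z : ℂ) :
    t.affineRoot (p + m • t.delta) z = t.affineRoot p z + m := by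
  rw [map_add, map_smul, AffineMap.coe_add, Pi.add_apply, AffineMap.coe_smul, Pi.smul_apply,
    affineRoot_delta, zsmul_one]

theorem affineRoot_add_right (t : AffineType) (p : Fin 3 → ℤ) (z d : ℂ) :
    t.affineRoot p (z + d) = t.affineRoot p z + (t.affineRoot p).linear d := by
  rw [add_comm, ← vadd_eq_add, AffineMap.map_vadd, vadd_eq_add, add_comm]

theorem affineRoot_vertex (t : AffineType) (p : Fin 3 → ℤ) (k : Fin 3) :
    t.affineRoot p (t.vertex k) = p k / t.delta k := by
  simp [affineRoot_apply, ← vertexBasis_apply, AffineBasis.coord_apply, div_eq_mul_inv]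

theorem affineRoot_injective (t : AffineType) : Function.Injective t.affineRoot := by
  intro p p' h
  ext k
  have hk := congrArg (fun f => f (t.vertex k)) h
  simp only [affineRoot_vertex, div_left_inj' (t.cast_delta_pos k).ne', Int.cast_inj] at hk
  exact hk

theorem affineRoot_linear_delta (t : AffineType) (d : ℂ) : (t.affineRoot t.delta).linear d = 0 := by
  have h := (t.affineRoot t.delta).map_vadd 0 d
  rw [affineRoot_delta, affineRoot_delta, vadd_eq_add] at h
  exact left_eq_add.mp (h.trans (add_comm _ _))

/-- The vector along which the `i`-th side reflection moves the points of the plane. -/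
def coroot (t : AffineType) (i : Fin 3) : ℂ :=
  ∑ k, ((t.cartan i k * t.delta k : ℤ) : ℝ) • t.vertex k

theorem sideReflection_vertex_of_ne (t : AffineType) {i j : Fin 3} (h : j ≠ i) :
    t.sideReflection i (t.vertex j) = t.vertex j := by
  rw [sideReflection, EuclideanGeometry.reflection_eq_self_iff]
  have : j = i + 1 ∨ j = i + 2 := by decide +revert
  rcases this with rfl | rfl
  · exact left_mem_affineSpan_pair ℝ _ _
  · exact right_mem_affineSpan_pair ℝ _ _

theorem inner_coroot_vertex_sub (t : AffineType) (i : Fin 3) :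
    inner ℝ (t.vertex (i + 2) - t.vertex (i + 1)) (t.coroot i) = 0 := by
  have h3 : √3 * √3 = 3 := Real.mul_self_sqrt (by norm_num)
  cases t <;> fin_cases i <;>
    simp [coroot, cartan, delta, vertex, Fin.sum_univ_three, Complex.inner] <;> linarith

theorem vertex_sub_coroot_mem (t : AffineType) (i : Fin 3) :
    t.vertex i - (2 * t.delta i : ℝ)⁻¹ • t.coroot i ∈
      affineSpan ℝ {t.vertex (i + 1), t.vertex (i + 2)} := by
  convert AffineMap.lineMap_mem_affineSpan_pair
    (-(t.cartan i (i + 2) * t.delta (i + 2)) / (2 * t.delta i) : ℝ) _ _ using 1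
  cases t <;> fin_cases i <;>
    simp [AffineMap.lineMap_apply, coroot, cartan, delta, vertex, Fin.sum_univ_three,
      Complex.ext_iff] <;> norm_num <;> ring

theorem sideReflection_vertex_self (t : AffineType) (i : Fin 3) :
    t.sideReflection i (t.vertex i) = t.vertex i - (t.delta i : ℝ)⁻¹ • t.coroot i := by
  have horth : (2 * t.delta i : ℝ)⁻¹ • t.coroot i ∈
      (affineSpan ℝ {t.vertex (i + 1), t.vertex (i + 2)}).directionᗮ := by
    rw [direction_affineSpan, vectorSpan_pair_rev]
    exact Submodule.smul_mem _ _
      (Submodule.mem_orthogonal_singleton_iff_inner_right.mpr (t.inner_coroot_vertex_sub i))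
  have h := EuclideanGeometry.reflection_orthogonal_vadd (t.vertex_sub_coroot_mem i) horth
  rw [vadd_eq_add, add_sub_cancel, vadd_eq_add] at h
  rw [sideReflection, h, mul_inv, mul_smul]
  module

theorem sideReflection_apply (t : AffineType) (i : Fin 3) (z : ℂ) :
    t.sideReflection i z = z - t.affineRoot (simpleRoot i) z • t.coroot i := by
  let f : ℂ →ᵃ[ℝ] ℂ := AffineMap.id ℝ ℂ -
    (LinearMap.toSpanSingleton ℝ ℂ (t.coroot i)).toAffineMap.comp (t.affineRoot (simpleRoot i))
  suffices h : (t.sideReflection i).toAffineEquiv.toAffineMap = f from DFunLike.congr_fun h z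
  refine AffineMap.ext_on t.vertexBasis.tot ?_
  rintro _ ⟨j, rfl⟩
  change t.sideReflection i (t.vertex j) =
    t.vertex j - t.affineRoot (simpleRoot i) (t.vertex j) • t.coroot i
  rw [affineRoot_vertex]
  rcases eq_or_ne j i with rfl | h
  · rw [sideReflection_vertex_self, simpleRoot, Pi.single_eq_same, Int.cast_one, one_div]
  · simp [sideReflection_vertex_of_ne t h, h]

theorem affineRoot_linear_vertex (t : AffineType) (p : Fin 3 → ℤ) (k : Fin 3) :
    (t.affineRoot p).linear (t.vertex k) = p k / t.delta k - p 2 := by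
  have h0 : t.vertex 2 = 0 ∧ t.delta 2 = 1 := by cases t <;> simp [vertex, delta]
  have h := (t.affineRoot p).linearMap_vsub (t.vertex k) (t.vertex 2)
  rwa [affineRoot_vertex, affineRoot_vertex, h0.1, h0.2, vsub_eq_sub, sub_zero, Int.cast_one,
    div_one, vsub_eq_sub] at h

theorem cartan_mulVec_delta (t : AffineType) : t.cartan.mulVec t.delta = 0 := by
  cases t <;> decide

theorem affineRoot_linear_coroot (t : AffineType) (i : Fin 3) (p : Fin 3 → ℤ) :
    (t.affineRoot p).linear (t.coroot i) = t.cartan.mulVec p i := by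
  have hδ : ∑ k, (t.cartan i k * t.delta k : ℝ) = 0 := by
    exact_mod_cast congrFun t.cartan_mulVec_delta i
  simp only [coroot, map_sum, map_smul, affineRoot_linear_vertex, smul_eq_mul, mul_sub,
    Finset.sum_sub_distrib, ← Finset.sum_mul, Int.cast_mul, hδ, zero_mul, sub_zero,
    Matrix.mulVec, dotProduct, Int.cast_sum]
  refine Finset.sum_congr rfl fun k _ => ?_
  rw [mul_assoc, mul_div_cancel₀ _ (t.cast_delta_pos k).ne']

theorem cartan_mulVec_simpleRoot_self (t : AffineType) :
    ∀ i, t.cartan.mulVec (simpleRoot i) i = 2 := by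
  cases t <;> decide

theorem affineRoot_rootReflection (t : AffineType) (i : Fin 3) (p : Fin 3 → ℤ) (z : ℂ) :
    t.affineRoot (t.rootReflection i p) (t.sideReflection i z) = t.affineRoot p z := by
  have hp (p : Fin 3 → ℤ) : t.affineRoot p (t.sideReflection i z) = t.affineRoot p z -
      t.affineRoot (simpleRoot i) z * t.cartan.mulVec p i := by
    rw [sideReflection_apply, sub_eq_neg_add, ← vadd_eq_add, AffineMap.map_vadd, map_neg, map_smul,
      affineRoot_linear_coroot, vadd_eq_add, smul_eq_mul, neg_add_eq_sub]
  rw [rootReflection_apply, map_sub, map_smul, AffineMap.coe_sub, Pi.sub_apply, hp,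
    AffineMap.coe_smul, Pi.smul_apply, hp, cartan_mulVec_simpleRoot_self, zsmul_eq_mul]
  push_cast
  ring

end AffineType

section PlaneAction

open AffineType

variable {W : Type*} [Group W] {t : AffineType} {cs : CoxeterSystem t.coxeterMatrix W}

theorem planeAction_simple (i : Fin 3) : planeAction cs (cs.simple i) = t.sideReflection i :=
  cs.lift_apply_simple t.isLiftable_sideReflection i

theorem affineRoot_rootRep (w : W) (p : Fin 3 → ℤ) (z : ℂ) :
    t.affineRoot (rootRep cs w p) (planeAction cs w z) = t.affineRoot p z := by
  induction w using cs.simple_induction_left with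
  | one => rw [map_one, map_one]; rfl
  | mul_simple_left w i ih =>
    rw [map_mul, map_mul, Module.End.mul_apply, AffineIsometryEquiv.coe_mul, Function.comp_apply,
      rootRep_simple, planeAction_simple, affineRoot_rootReflection, ih]

theorem affineRoot_rootRep_linear (w : W) (p : Fin 3 → ℤ) (d : ℂ) :
    (t.affineRoot (rootRep cs w p)).linear ((planeAction cs w).linearIsometryEquiv d) =
      (t.affineRoot p).linear d := by
  have h := affineRoot_rootRep (cs := cs) w p (d +ᵥ (0 : ℂ))
  rw [AffineIsometryEquiv.map_vadd, AffineMap.map_vadd, AffineMap.map_vadd,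
    affineRoot_rootRep] at h
  exact vadd_right_cancel _ h

theorem planeAction_image_preimage (w : W) (p : Fin 3 → ℤ) (s : Set ℝ) :
    planeAction cs w '' (t.affineRoot p ⁻¹' s) = t.affineRoot (rootRep cs w p) ⁻¹' s := by
  ext z
  obtain ⟨z, rfl⟩ := (planeAction cs w).surjective z
  rw [(planeAction cs w).injective.mem_set_image, Set.mem_preimage, Set.mem_preimage,
    affineRoot_rootRep]

theorem planeAction_simple_eq_self_iff (i : Fin 3) (z : ℂ) :
    planeAction cs (cs.simple i) z = z ↔ t.affineRoot (simpleRoot i) z = 0 := by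
  have hcoroot : t.coroot i ≠ 0 := by
    intro h
    have h2 := t.affineRoot_linear_coroot i (simpleRoot i)
    rw [h, map_zero, cartan_mulVec_simpleRoot_self] at h2
    norm_num at h2
  rw [planeAction_simple, sideReflection_apply, sub_eq_self, smul_eq_zero, or_iff_left hcoroot]

theorem mem_wall_conj_iff (w : W) (i : Fin 3) (z : ℂ) :
    z ∈ wall cs (w * cs.simple i * w⁻¹) ↔ t.affineRoot (rootRep cs w (simpleRoot i)) z = 0 := by
  obtain ⟨z, rfl⟩ := (planeAction cs w).surjective z
  have hconj : planeAction cs (w * cs.simple i * w⁻¹) (planeAction cs w z) =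
      planeAction cs w (planeAction cs (cs.simple i) z) := by
    simp only [← Function.comp_apply (f := planeAction cs _), ← AffineIsometryEquiv.coe_mul,
      ← map_mul, inv_mul_cancel_right]
  rw [wall, Set.mem_ofPred_eq, hconj, (planeAction cs w).injective.eq_iff,
    planeAction_simple_eq_self_iff, affineRoot_rootRep]

theorem mem_parallelWalls_iff (d z : ℂ) :
    z ∈ parallelWalls cs d ↔ ∃ w i, (t.affineRoot (rootRep cs w (simpleRoot i))).linear d = 0 ∧
      t.affineRoot (rootRep cs w (simpleRoot i)) z = 0 := by
  constructor
  · rintro ⟨_, ⟨w, i, rfl⟩, hd, hz⟩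
    have hzd := (mem_wall_conj_iff w i _).mp (hd z hz)
    rw [mem_wall_conj_iff] at hz
    rw [affineRoot_add_right, hz, zero_add] at hzd
    exact ⟨w, i, hzd, hz⟩
  · rintro ⟨w, i, hd, hz⟩
    refine ⟨_, ⟨w, i, rfl⟩, fun x hx => ?_, (mem_wall_conj_iff w i z).mpr hz⟩
    rw [mem_wall_conj_iff] at hx ⊢
    rw [affineRoot_add_right, hx, hd, add_zero]

end PlaneAction

section FundamentalStrip

theorem connectedComponentIn_eq_preimage_Ioo {X : Type*} [TopologicalSpace X] {f : X → ℝ}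
    {F : Set X} {a b : ℝ} {x : X} (hf : Continuous f) (hconn : IsPreconnected (f ⁻¹' Set.Ioo a b))
    (hF : f ⁻¹' Set.Ioo a b ⊆ F) (ha : ∀ y ∈ F, f y ≠ a) (hb : ∀ y ∈ F, f y ≠ b)
    (hx : f x ∈ Set.Ioo a b) : connectedComponentIn F x = f ⁻¹' Set.Ioo a b := by
  refine (Set.Subset.antisymm fun y hy => ?_) (hconn.subset_connectedComponentIn hx hF)
  have hord : (f '' connectedComponentIn F x).OrdConnected :=
    (isPreconnected_connectedComponentIn.image f hf.continuousOn).ordConnected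
  have hfx := Set.mem_image_of_mem f (mem_connectedComponentIn (hF hx))
  have hfy := Set.mem_image_of_mem f hy
  by_contra! h
  rw [Set.mem_preimage, Set.mem_Ioo, not_and_or, not_lt, not_lt] at h
  rcases h with h | h
  · obtain ⟨v, hv, hva⟩ := hord.out hfy hfx ⟨h, hx.1.le⟩
    exact ha v (connectedComponentIn_subset F x hv) hva
  · obtain ⟨v, hv, hvb⟩ := hord.out hfx hfy ⟨hx.2.le, h⟩
    exact hb v (connectedComponentIn_subset F x hv) hvb

namespace AffineType

theorem chamber_eq (t : AffineType) : t.chamber = {z | ∀ k, 0 < t.affineRoot (simpleRoot k) z} := by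
  have hrange : t.chamber = interior (convexHull ℝ (Set.range t.vertexBasis)) := rfl
  simp only [hrange, AffineBasis.interior_convexHull, affineRoot_simpleRoot,
    mul_pos_iff_of_pos_left (inv_pos.mpr (t.cast_delta_pos _))]

theorem chamber_nonempty (t : AffineType) : t.chamber.Nonempty :=
  ⟨_, t.vertexBasis.centroid_mem_interior_convexHull⟩

theorem affineRoot_simpleRoot_mem_Ioo (t : AffineType) (k : Fin 3) {z : ℂ} (hz : z ∈ t.chamber) :
    t.affineRoot (simpleRoot k) z ∈ Set.Ioo (0 : ℝ) 1 := by
  rw [chamber_eq] at hz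
  have hcoord (j : Fin 3) : 0 < t.vertexBasis.coord j z :=
    pos_of_mul_pos_right (t.affineRoot_simpleRoot j z ▸ hz j) (inv_pos.mpr (t.cast_delta_pos j)).le
  have hδ : (t.delta k : ℝ)⁻¹ ≤ 1 :=
    inv_le_one_of_one_le₀ (Int.cast_one_le_of_pos (t.delta_pos k))
  have hlt : t.vertexBasis.coord k z < ∑ j, t.vertexBasis.coord j z :=
    Finset.single_lt_sum (j := k + 1) (add_ne_left.mpr one_ne_zero) (Finset.mem_univ _)
      (Finset.mem_univ _) (hcoord _) fun j _ _ => (hcoord j).le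
  rw [t.vertexBasis.sum_coord_apply_eq_one] at hlt
  exact ⟨hz k, (t.affineRoot_simpleRoot k z).trans_lt
    ((mul_le_of_le_one_left (hcoord k).le hδ).trans_lt hlt)⟩

/-- The simple root that vanishes on the line `ℝ vᵢ`, one of the two sides of the `i`-th fundamental
strip. -/
abbrev normalRoot (i : Fin 2) : Fin 3 → ℤ := simpleRoot i.rev.castSucc

theorem affineRoot_linear_normalRoot (t : AffineType) (i : Fin 2) :
    (t.affineRoot (normalRoot i)).linear (t.vertex i.castSucc) = 0 := by
  rw [affineRoot_linear_vertex]
  fin_cases i <;> simp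

theorem exists_eq_smul_normalRoot_add (t : AffineType) {i : Fin 2} {p : Fin 3 → ℤ}
    (h : (t.affineRoot p).linear (t.vertex i.castSucc) = 0) :
    ∃ x m : ℤ, p = x • normalRoot i + m • t.delta := by
  have hδ : t.delta 2 = 1 := by cases t <;> rfl
  rw [affineRoot_linear_vertex, sub_eq_zero, div_eq_iff (t.cast_delta_pos _).ne'] at h
  norm_cast at h
  refine ⟨p i.rev.castSucc - p 2 * t.delta i.rev.castSucc, p 2, ?_⟩
  ext l
  fin_cases i <;> fin_cases l <;> simp_all [normalRoot]

theorem affineRoot_simpleRoot_surjective (t : AffineType) (k : Fin 3) :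
    Function.Surjective (t.affineRoot (simpleRoot k)) := by
  rw [← AffineMap.linear_surjective_iff]
  refine LinearMap.surjective fun h => ?_
  have h2 := t.affineRoot_linear_coroot k (simpleRoot k)
  rw [h, cartan_mulVec_simpleRoot_self] at h2
  norm_num at h2

theorem exists_dotProduct_simpleRoot_eq_one (t : AffineType) (k : Fin 3) :
    ∃ c : Fin 3 → ℤ, c ⬝ᵥ simpleRoot k = 1 ∧ c ⬝ᵥ t.delta = 0 := by
  cases t <;> fin_cases k
  exacts [⟨![1, -1, 0], by decide⟩, ⟨![0, 1, -1], by decide⟩, ⟨![-1, 0, 1], by decide⟩,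
    ⟨![1, -2, 0], by decide⟩, ⟨![0, 1, -1], by decide⟩, ⟨![0, -1, 1], by decide⟩,
    ⟨![1, 0, -2], by decide⟩, ⟨![0, 1, -3], by decide⟩, ⟨![1, -1, 1], by decide⟩]

end AffineType

open AffineType

variable {W : Type*} [Group W] {t : AffineType} {cs : CoxeterSystem t.coxeterMatrix W}

theorem exists_rootRep_simpleRoot_eq_of_linear_eq_zero {w : W} {k : Fin 3} {i : Fin 2}
    (h : (t.affineRoot (rootRep cs w (simpleRoot k))).linear (t.vertex i.castSucc) = 0) :
    ∃ m : ℤ, rootRep cs w (simpleRoot k) = normalRoot i + m • t.delta ∨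
      rootRep cs w (simpleRoot k) = -normalRoot i + m • t.delta := by
  obtain ⟨x, m, hxm⟩ := t.exists_eq_smul_normalRoot_add h
  obtain ⟨c, hc, hcδ⟩ := t.exists_dotProduct_simpleRoot_eq_one k
  have hk : simpleRoot k = x • rootRep cs w⁻¹ (normalRoot i) + m • t.delta := by
    rw [← (rootRep cs).inv_self_apply w (simpleRoot k), hxm, map_add, map_smul, map_smul,
      rootRep_delta]
  rw [hk, dotProduct_add, dotProduct_smul, dotProduct_smul, hcδ, smul_zero, add_zero,
    smul_eq_mul] at hc
  refine ⟨m, (Int.isUnit_iff.mp (IsUnit.of_mul_eq_one _ hc)).imp ?_ ?_⟩ <;> rintro rfl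
  · rw [hxm, one_smul]
  · rw [hxm, neg_one_smul]

theorem exists_rootRep_simpleRoot_eq_delta_sub (cs : CoxeterSystem t.coxeterMatrix W) (i : Fin 2) :
    ∃ w k, rootRep cs w (simpleRoot k) = t.delta - normalRoot i := by
  have key : ∃ ω : List (Fin 3), ∃ k, ∀ l,
      t.rootAction ω (simpleRoot k) l = (t.delta - normalRoot i) l := by
    cases t <;> fin_cases i
    exacts [⟨[0], 2, by decide⟩, ⟨[1], 2, by decide⟩, ⟨[0], 2, by decide⟩, ⟨[2, 1], 0, by decide⟩,
      ⟨[0, 1, 2, 0], 1, by decide⟩, ⟨[2, 1], 0, by decide⟩]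
  obtain ⟨ω, k, h⟩ := key
  exact ⟨cs.wordProd ω, k, (LinearMap.congr_fun (rootRep_wordProd ω) _).trans (funext h)⟩

theorem preimage_Ioo_subset_compl_parallelWalls (cs : CoxeterSystem t.coxeterMatrix W) (i : Fin 2) :
    t.affineRoot (normalRoot i) ⁻¹' Set.Ioo 0 1 ⊆ (parallelWalls cs (t.vertex i.castSucc))ᶜ := by
  rintro z ⟨hz0, hz1⟩ hwall
  obtain ⟨w, k, hd, hz⟩ := (mem_parallelWalls_iff (cs := cs) _ _).mp hwall
  obtain ⟨m, h | h⟩ := exists_rootRep_simpleRoot_eq_of_linear_eq_zero hd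
  · have hm : t.affineRoot (normalRoot i) z = (-m : ℤ) := by
      rw [h, affineRoot_add_smul_delta] at hz
      rw [Int.cast_neg, eq_neg_of_add_eq_zero_left hz]
    rw [hm] at hz0 hz1
    norm_cast at hz0 hz1
    omega
  · have hm : t.affineRoot (normalRoot i) z = m := by
      rw [h, affineRoot_add_smul_delta, map_neg] at hz
      exact neg_add_eq_zero.mp hz
    rw [hm] at hz0 hz1
    norm_cast at hz0 hz1
    omega

theorem fundamentalStrip_eq (cs : CoxeterSystem t.coxeterMatrix W) (i : Fin 2) :
    fundamentalStrip cs i = t.affineRoot (normalRoot i) ⁻¹' Set.Ioo 0 1 := by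
  have hzero : ∀ z ∈ (parallelWalls cs (t.vertex i.castSucc))ᶜ,
      t.affineRoot (normalRoot i) z ≠ 0 := fun z hz h =>
    hz ((mem_parallelWalls_iff (cs := cs) _ _).mpr ⟨1, i.rev.castSucc, by
      rw [map_one]; exact ⟨t.affineRoot_linear_normalRoot i, h⟩⟩)
  have hone : ∀ z ∈ (parallelWalls cs (t.vertex i.castSucc))ᶜ,
      t.affineRoot (normalRoot i) z ≠ 1 := fun z hz h => by
    obtain ⟨w, k, hw⟩ := exists_rootRep_simpleRoot_eq_delta_sub cs i
    refine hz ((mem_parallelWalls_iff _ _).mpr ⟨w, k, ?_⟩)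
    rw [hw, map_sub]
    simp [affineRoot_linear_delta, affineRoot_linear_normalRoot, affineRoot_delta, h]
  have hcomp : ∀ z ∈ t.chamber, connectedComponentIn
      (parallelWalls cs (t.vertex i.castSucc))ᶜ z = t.affineRoot (normalRoot i) ⁻¹' Set.Ioo 0 1 :=
    fun z hz => connectedComponentIn_eq_preimage_Ioo
      (t.affineRoot (normalRoot i)).continuous_of_finiteDimensional
      ((convex_Ioo 0 1).affine_preimage _).isPreconnected
      (preimage_Ioo_subset_compl_parallelWalls cs i) hzero hone
      (t.affineRoot_simpleRoot_mem_Ioo _ hz)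
  rw [fundamentalStrip, Set.iUnion₂_congr hcomp, Set.biUnion_const t.chamber_nonempty]

end FundamentalStrip

section StripTranslations

namespace AffineType

/-- An element of the root lattice whose linear part is a positive multiple of the inner product
with the direction `vᵢ` of the fundamental strip. -/
def tangentVector : AffineType → Fin 2 → Fin 3 → ℤ
  | A2 => ![![1, 0, -1], ![0, 1, -1]]
  | C2 => ![![0, 0, -1], ![0, 1, -1]]
  | G2 => ![![0, 0, -1], ![0, 1, -1]]

theorem exists_eq_sum_smul_vertex (t : AffineType) (d : ℂ) :
    ∃ x : Fin 3 → ℝ, d = ∑ k, x k • t.vertex k :=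
  ⟨_, (t.vertexBasis.linear_combination_coord_eq_self d).symm⟩

theorem vertex_two (t : AffineType) : t.vertex 2 = 0 := by cases t <;> rfl

theorem vertex_castSucc_ne_zero (t : AffineType) (i : Fin 2) : t.vertex i.castSucc ≠ 0 := by
  cases t <;> fin_cases i <;> simp [vertex, Complex.ext_iff]

theorem exists_affineRoot_tangentVector_linear_eq (t : AffineType) (i : Fin 2) :
    ∃ c : ℝ, 0 < c ∧ ∀ d, (t.affineRoot (t.tangentVector i)).linear d =
      c * inner ℝ (t.vertex i.castSucc) d := by
  obtain ⟨c, hc, hv⟩ : ∃ c : ℝ, 0 < c ∧ ∀ k,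
      (t.tangentVector i k / t.delta k - t.tangentVector i 2 : ℝ) =
        c * inner ℝ (t.vertex i.castSucc) (t.vertex k) := by
    have h3 : √3 * √3 = 3 := Real.mul_self_sqrt (by norm_num)
    refine ⟨match t with | A2 => 2 | C2 => 2 | G2 => 4 / 3, by cases t <;> norm_num, fun k => ?_⟩
    cases t <;> fin_cases i <;> fin_cases k <;>
      simp [tangentVector, delta, vertex, Complex.inner, Complex.sq_norm, Complex.normSq_apply] <;>
      linarith
  refine ⟨c, hc, fun d => ?_⟩
  obtain ⟨x, rfl⟩ := t.exists_eq_sum_smul_vertex d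
  simp only [map_sum, map_smul, affineRoot_linear_vertex, hv, inner_sum, inner_smul_right,
    Finset.mul_sum, smul_eq_mul, mul_left_comm]

theorem affineRoot_tangentVector_linear_pos (t : AffineType) (i : Fin 2) :
    0 < (t.affineRoot (t.tangentVector i)).linear (t.vertex i.castSucc) := by
  obtain ⟨c, hc, h⟩ := t.exists_affineRoot_tangentVector_linear_eq i
  rw [h]
  exact mul_pos hc (real_inner_self_pos.mpr (t.vertex_castSucc_ne_zero i))

theorem eq_zero_of_affineRoot_linear_eq_zero (t : AffineType) {i : Fin 2} {d : ℂ}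
    (hn : (t.affineRoot (normalRoot i)).linear d = 0)
    (ht : (t.affineRoot (t.tangentVector i)).linear d = 0) : d = 0 := by
  obtain ⟨x, rfl⟩ := t.exists_eq_sum_smul_vertex d
  have hpos := t.affineRoot_tangentVector_linear_pos i
  rw [map_sum] at hn
  have hx : x i.rev.castSucc = 0 := by
    simp only [map_smul, affineRoot_linear_vertex] at hn
    fin_cases i <;>
      simpa [Fin.sum_univ_three, normalRoot, (t.cast_delta_pos _).ne'] using hn
  have hsum : ∑ k, x k • t.vertex k = x i.castSucc • t.vertex i.castSucc := by
    refine Finset.sum_eq_single _ (fun k _ hk => ?_) (fun h => absurd (Finset.mem_univ _) h)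
    have hcases : ∀ (i : Fin 2) (k : Fin 3), k ≠ i.castSucc → k = i.rev.castSucc ∨ k = 2 := by
      decide
    rcases hcases i k hk with rfl | rfl
    · rw [hx, zero_smul]
    · rw [vertex_two, smul_zero]
  rw [hsum, map_smul, smul_eq_mul, mul_eq_zero, or_iff_left hpos.ne'] at ht
  rw [hsum, ht, zero_smul]

theorem eq_of_affineRoot_eq (t : AffineType) {i : Fin 2} {z z' : ℂ}
    (hn : t.affineRoot (normalRoot i) z = t.affineRoot (normalRoot i) z')
    (ht : t.affineRoot (t.tangentVector i) z = t.affineRoot (t.tangentVector i) z') : z = z' := by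
  refine sub_eq_zero.mp (t.eq_zero_of_affineRoot_linear_eq_zero (i := i) ?_ ?_)
  · rw [← vsub_eq_sub, AffineMap.linearMap_vsub, hn, vsub_self]
  · rw [← vsub_eq_sub, AffineMap.linearMap_vsub, ht, vsub_self]

theorem exists_eq_smul_delta (t : AffineType) {p : Fin 3 → ℤ}
    (h : (t.affineRoot p).linear = 0) : ∃ m : ℤ, p = m • t.delta := by
  refine ⟨p 2, funext fun k => ?_⟩
  have hk := t.affineRoot_linear_vertex p k
  rw [h, LinearMap.zero_apply, eq_comm, sub_eq_zero, div_eq_iff (t.cast_delta_pos k).ne'] at hk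
  exact_mod_cast hk

end AffineType

open AffineType

theorem middleLine_preimage_Ioo {f : ℂ →ᵃ[ℝ] ℝ} (hf : Function.Surjective f) :
    middleLine (f ⁻¹' Set.Ioo 0 1) = f ⁻¹' {1 / 2} := by
  have himage (z : ℂ) : Equiv.pointReflection z '' (f ⁻¹' Set.Ioo 0 1) =
      f ⁻¹' Set.Ioo (2 * f z - 1) (2 * f z) := by
    ext x
    have hx : f (Equiv.pointReflection z x) = 2 * f z - f x := by
      rw [Equiv.pointReflection_apply, AffineMap.map_vadd, AffineMap.linearMap_vsub, vadd_eq_add,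
        vsub_eq_sub]
      ring
    rw [Equiv.image_eq_preimage_symm, Equiv.pointReflection_symm, Set.mem_preimage,
      Set.mem_preimage, Set.mem_preimage, hx, Set.mem_Ioo, Set.mem_Ioo, sub_pos,
      sub_lt_comm, and_comm]
  ext z
  rw [middleLine, Set.mem_ofPred_eq, himage, hf.preimage_injective.eq_iff, Set.mem_preimage,
    Set.mem_singleton_iff]
  refine ⟨fun h => ?_, fun h => by rw [h]; norm_num⟩
  have hinf := congrArg sInf h
  rw [csInf_Ioo (sub_one_lt _), csInf_Ioo one_pos] at hinf
  linarith

variable {W : Type*} [Group W] {t : AffineType} {cs : CoxeterSystem t.coxeterMatrix W}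

variable (cs) in
/-- `w` acts on the root lattice as an element of the stabilizer of the fundamental strip which
moves the middle line of the strip so that the value of the tangent vector increases by `y`. The
strip is the set of points where the normal root has values between `0` and `1`; a glide
reflection interchanges the two sides. -/
structure IsStripTranslation (i : Fin 2) (w : W) (y : ℤ) : Prop where
  map_normalRoot : rootRep cs w (normalRoot i) = normalRoot i ∨
    rootRep cs w (normalRoot i) = t.delta - normalRoot i
  map_tangentVector : rootRep cs w (t.tangentVector i) = t.tangentVector i - y • t.delta

variable {i : Fin 2} {w v : W} {y y' : ℤ}

theorem affineRoot_delta_sub (p : Fin 3 → ℤ) (z : ℂ) :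
    t.affineRoot (t.delta - p) z = 1 - t.affineRoot p z := by
  rw [map_sub, AffineMap.coe_sub, Pi.sub_apply, affineRoot_delta]

namespace IsStripTranslation

theorem affineRoot_tangentVector (h : IsStripTranslation cs i w y) (z : ℂ) :
    t.affineRoot (t.tangentVector i) (planeAction cs w z) =
      t.affineRoot (t.tangentVector i) z + y := by
  have hz := affineRoot_rootRep (cs := cs) w (t.tangentVector i) z
  rwa [h.map_tangentVector, sub_eq_add_neg, ← neg_smul, affineRoot_add_smul_delta, Int.cast_neg,
    ← sub_eq_add_neg, sub_eq_iff_eq_add] at hz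

theorem linearIsometryEquiv_vertex (h : IsStripTranslation cs i w y) :
    (planeAction cs w).linearIsometryEquiv (t.vertex i.castSucc) = t.vertex i.castSucc := by
  have hn := affineRoot_rootRep_linear (cs := cs) w (normalRoot i) (t.vertex i.castSucc)
  have ht := affineRoot_rootRep_linear (cs := cs) w (t.tangentVector i) (t.vertex i.castSucc)
  rw [affineRoot_linear_normalRoot] at hn
  rw [h.map_tangentVector, map_sub, map_smul] at ht
  refine sub_eq_zero.mp (t.eq_zero_of_affineRoot_linear_eq_zero (i := i) ?_ ?_)
  · rw [map_sub, affineRoot_linear_normalRoot, sub_zero]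
    rcases h.map_normalRoot with hw | hw <;> rw [hw] at hn
    · exact hn
    · simpa [affineRoot_linear_delta] using hn
  · rw [map_sub, sub_eq_zero]
    simpa [affineRoot_linear_delta] using ht

theorem planeAction_image_fundamentalStrip (h : IsStripTranslation cs i w y) :
    planeAction cs w '' fundamentalStrip cs i = fundamentalStrip cs i := by
  rw [fundamentalStrip_eq, planeAction_image_preimage]
  rcases h.map_normalRoot with hw | hw <;> rw [hw]
  ext z
  rw [Set.mem_preimage, Set.mem_preimage, affineRoot_delta_sub, Set.mem_Ioo, Set.mem_Ioo, sub_pos,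
    sub_lt_self_iff, and_comm]

end IsStripTranslation

theorem strip_one (cs : CoxeterSystem t.coxeterMatrix W) (i : Fin 2) :
    strip cs 1 i = fundamentalStrip cs i := by
  rw [strip, map_one, AffineIsometryEquiv.coe_one, Set.image_id]

theorem stripDirection_one (cs : CoxeterSystem t.coxeterMatrix W) (i : Fin 2) :
    stripDirection cs 1 i = t.vertex i.castSucc := by
  rw [stripDirection, map_one]
  rfl

theorem rootRep_normalRoot_of_image_fundamentalStrip_eq
    (hstrip : planeAction cs w '' fundamentalStrip cs i = fundamentalStrip cs i)
    (hdir : (planeAction cs w).linearIsometryEquiv (t.vertex i.castSucc) = t.vertex i.castSucc) :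
    rootRep cs w (normalRoot i) = normalRoot i ∨
      rootRep cs w (normalRoot i) = t.delta - normalRoot i := by
  have hlin := affineRoot_rootRep_linear (cs := cs) w (normalRoot i) (t.vertex i.castSucc)
  rw [hdir, affineRoot_linear_normalRoot] at hlin
  obtain ⟨z, hz⟩ := t.affineRoot_simpleRoot_surjective i.rev.castSucc (1 / 2)
  have hmem : z ∈ t.affineRoot (rootRep cs w (normalRoot i)) ⁻¹' Set.Ioo 0 1 := by
    rw [← planeAction_image_preimage, ← fundamentalStrip_eq cs, hstrip, fundamentalStrip_eq,
      Set.mem_preimage, hz]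
    norm_num
  obtain ⟨m, h | h⟩ := exists_rootRep_simpleRoot_eq_of_linear_eq_zero hlin <;>
    rw [h, Set.mem_preimage, affineRoot_add_smul_delta, Set.mem_Ioo] at hmem
  · rw [hz] at hmem
    have hm : -1 < m ∧ m < 1 := by
      constructor <;> rify <;> linarith
    obtain rfl : m = 0 := by omega
    left
    rw [h, zero_smul, add_zero]
  · rw [map_neg, AffineMap.coe_neg, Pi.neg_apply, hz] at hmem
    have hm : 0 < m ∧ m < 2 := by
      constructor <;> rify <;> linarith
    obtain rfl : m = 1 := by omega
    right
    rw [h, one_smul, neg_add_eq_sub]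

theorem exists_rootRep_tangentVector_eq
    (hdir : (planeAction cs w).linearIsometryEquiv (t.vertex i.castSucc) = t.vertex i.castSucc) :
    ∃ y : ℤ, rootRep cs w (t.tangentVector i) = t.tangentVector i - y • t.delta := by
  obtain ⟨c, -, hc⟩ := t.exists_affineRoot_tangentVector_linear_eq i
  have hlin : (t.affineRoot (t.tangentVector i - rootRep cs w (t.tangentVector i))).linear = 0 := by
    refine LinearMap.ext fun d => ?_
    obtain ⟨d, rfl⟩ := (planeAction cs w).linearIsometryEquiv.surjective d
    have hinner := (planeAction cs w).linearIsometryEquiv.inner_map_map (t.vertex i.castSucc) d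
    rw [hdir] at hinner
    rw [map_sub, AffineMap.sub_linear, LinearMap.sub_apply, affineRoot_rootRep_linear, hc, hc,
      hinner, sub_self, LinearMap.zero_apply]
  obtain ⟨y, hy⟩ := t.exists_eq_smul_delta hlin
  exact ⟨y, by rw [← hy, sub_sub_cancel]⟩

theorem mem_stripStabilizer_one_iff :
    w ∈ stripStabilizer cs 1 i ↔ ∃ y, IsStripTranslation cs i w y := by
  change planeAction cs w '' strip cs 1 i = strip cs 1 i ∧ (planeAction cs w).linearIsometryEquiv
    (stripDirection cs 1 i) = stripDirection cs 1 i ↔ _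
  rw [strip_one, stripDirection_one]
  refine ⟨fun ⟨hstrip, hdir⟩ => ?_, fun ⟨y, h⟩ =>
    ⟨h.planeAction_image_fundamentalStrip, h.linearIsometryEquiv_vertex⟩⟩
  obtain ⟨y, hy⟩ := exists_rootRep_tangentVector_eq hdir
  exact ⟨y, rootRep_normalRoot_of_image_fundamentalStrip_eq hstrip hdir, hy⟩

end StripTranslations

section StripGenerators

open AffineType

variable {W : Type*} [Group W] {t : AffineType} {cs : CoxeterSystem t.coxeterMatrix W}
variable {i : Fin 2} {w v : W} {y y' : ℤ}

namespace IsStripTranslation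

theorem mul (hw : IsStripTranslation cs i w y) (hv : IsStripTranslation cs i v y') :
    IsStripTranslation cs i (w * v) (y + y') where
  map_normalRoot := by
    rw [map_mul, Module.End.mul_apply]
    rcases hv.map_normalRoot with h | h <;> rw [h]
    · exact hw.map_normalRoot
    · rw [map_sub, rootRep_delta]
      rcases hw.map_normalRoot with h' | h' <;> rw [h']
      · exact Or.inr rfl
      · exact Or.inl (sub_sub_cancel _ _)
  map_tangentVector := by
    rw [map_mul, Module.End.mul_apply, hv.map_tangentVector, map_sub, map_smul, rootRep_delta,
      hw.map_tangentVector, add_smul, sub_sub]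

theorem inv (h : IsStripTranslation cs i w y) : IsStripTranslation cs i w⁻¹ (-y) where
  map_normalRoot := by
    rcases h.map_normalRoot with hn | hn
    · left
      conv_lhs => rw [← hn]
      exact (rootRep cs).inv_self_apply w _
    · right
      have hinv := (rootRep cs).inv_self_apply w (normalRoot i)
      rw [hn, map_sub, rootRep_delta] at hinv
      exact eq_sub_of_add_eq (sub_eq_iff_eq_add'.mp hinv).symm
  map_tangentVector := by
    have ht := (rootRep cs).inv_self_apply w (t.tangentVector i)
    rw [h.map_tangentVector, map_sub, map_smul, rootRep_delta] at ht
    rw [neg_smul, sub_neg_eq_add, sub_eq_iff_eq_add.mp ht]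

end IsStripTranslation

theorem planeAction_injective : Function.Injective (planeAction cs) := by
  refine (injective_iff_map_eq_one _).mpr fun w hw => rootRep_injective (cs := cs) ?_
  rw [map_one]
  refine LinearMap.ext fun p => t.affineRoot_injective (AffineMap.ext fun z => ?_)
  have hz := affineRoot_rootRep (cs := cs) w p z
  rwa [hw] at hz

theorem dvd_rootRep_sub {m : ℤ} {p : Fin 3 → ℤ} (h : ∀ i, m ∣ t.cartan.mulVec p i) (w : W)
    (l : Fin 3) : m ∣ (rootRep cs w p - p) l := by
  induction w using cs.simple_induction_right with
  | one => simp
  | mul_simple_right w i ih =>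
    rw [map_mul, Module.End.mul_apply, rootRep_simple, rootReflection_apply, map_sub, map_smul,
      sub_right_comm]
    exact dvd_sub ih (dvd_mul_of_dvd_left (h i) _)

/-- The length of the translation of the middle line by the generator of the stabilizer of the
`i`-th strip, measured by the tangent vector. -/
def AffineType.period : AffineType → Fin 2 → ℤ
  | A2 => ![3, 3]
  | C2 => ![2, 2]
  | G2 => ![1, 2]

theorem AffineType.period_pos (t : AffineType) (i : Fin 2) : 0 < t.period i := by
  cases t <;> fin_cases i <;> decide

namespace IsStripTranslation

theorem period_dvd_and_map_normalRoot_eq (h : IsStripTranslation cs i w y) :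
    t.period i ∣ y ∧ (y = 0 → rootRep cs w (normalRoot i) = normalRoot i) := by
  have hn : rootRep cs w (normalRoot i) = normalRoot i ∧ rootRep cs w (normalRoot i) 2 = 0 ∨
      rootRep cs w (normalRoot i) 2 = 1 := by
    refine h.map_normalRoot.imp (fun hw => ⟨hw, ?_⟩) (fun hw => ?_) <;> rw [hw]
    · fin_cases i <;> rfl
    · cases t <;> fin_cases i <;> rfl
  have hδ := congrFun (rootRep_delta (cs := cs) w) 2
  have ht := congrFun h.map_tangentVector 2
  rw [rootRep_apply_eq_sum, Finset.sum_apply] at hδ ht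
  -- These congruences hold on the whole root lattice; they exclude the shorter translations.
  have hA2 : t = A2 → 3 ∣ (rootRep cs w (simpleRoot 0 - simpleRoot 1)) 2 := by
    rintro rfl
    simpa using dvd_rootRep_sub (cs := cs) (p := simpleRoot 0 - simpleRoot 1) (by decide) w 2
  have hC2 : t = C2 → 2 ∣ (rootRep cs w (simpleRoot 1)) 2 := by
    rintro rfl
    simpa using dvd_rootRep_sub (cs := cs) (p := simpleRoot 1) (by decide) w 2
  suffices t.period i ∣ y ∧ (y = 0 → rootRep cs w (normalRoot i) 2 ≠ 1) from
    this.imp_right fun h0 hy => (hn.resolve_right (h0 hy)).1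
  replace hn := hn.imp_left And.right
  cases t <;> fin_cases i <;>
    simp [period, AffineType.tangentVector, delta, normalRoot, Fin.sum_univ_three]
      at hA2 hC2 ht hδ hn ⊢ <;>
    omega

theorem eq_one (h : IsStripTranslation cs i w 0) : w = 1 := by
  refine planeAction_injective (cs := cs) ?_
  rw [map_one]
  refine AffineIsometryEquiv.ext fun z => t.eq_of_affineRoot_eq (i := i) ?_ ?_
  · have hz := affineRoot_rootRep (cs := cs) w (normalRoot i) z
    rwa [h.period_dvd_and_map_normalRoot_eq.2 rfl] at hz
  · rw [h.affineRoot_tangentVector, Int.cast_zero, add_zero]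
    rfl

theorem unique (hw : IsStripTranslation cs i w y) (hv : IsStripTranslation cs i v y) : w = v :=
  mul_inv_eq_one.mp (by simpa using (hw.mul hv.inv) : IsStripTranslation cs i _ 0).eq_one

theorem translatesMiddleLine_one_iff (h : IsStripTranslation cs i w y) (c : ℝ) :
    TranslatesMiddleLine cs 1 i w c ↔
      y = c * (t.affineRoot (t.tangentVector i)).linear (t.vertex i.castSucc) := by
  have hmid : middleLine (strip cs 1 i) = t.affineRoot (normalRoot i) ⁻¹' {1 / 2} := by
    rw [strip_one, fundamentalStrip_eq,
      middleLine_preimage_Ioo (t.affineRoot_simpleRoot_surjective _)]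
  rw [TranslatesMiddleLine, hmid, stripDirection_one]
  constructor
  · intro htrans
    obtain ⟨z, hz⟩ := t.affineRoot_simpleRoot_surjective i.rev.castSucc (1 / 2)
    have hy := h.affineRoot_tangentVector z
    rwa [htrans z hz, affineRoot_add_right, map_smul, add_right_inj, smul_eq_mul, eq_comm] at hy
  · intro hy z hz
    refine t.eq_of_affineRoot_eq (i := i) ?_ ?_
    · have hwz := affineRoot_rootRep (cs := cs) w (normalRoot i) z
      rw [Set.mem_preimage, Set.mem_singleton_iff] at hz
      rw [affineRoot_add_right, map_smul, affineRoot_linear_normalRoot, smul_zero, add_zero, hz]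
      rcases h.map_normalRoot with hw | hw <;> rw [hw, hz] at hwz
      · exact hwz
      · rw [affineRoot_delta_sub] at hwz
        linarith
    · rw [h.affineRoot_tangentVector, affineRoot_add_right, map_smul, hy, smul_eq_mul]

theorem isMinimalTranslation_one_iff (hv : IsStripTranslation cs i v (t.period i)) :
    IsMinimalTranslation cs 1 i w ↔ w = v := by
  have hκ := t.affineRoot_tangentVector_linear_pos i
  have hpos : (0 : ℝ) < t.period i := Int.cast_pos.mpr (t.period_pos i)
  set κ := (t.affineRoot (t.tangentVector i)).linear (t.vertex i.castSucc)
  have hvmem := mem_stripStabilizer_one_iff.mpr ⟨_, hv⟩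
  have hvtrans : TranslatesMiddleLine cs 1 i v (t.period i / κ) :=
    (hv.translatesMiddleLine_one_iff _).mpr (div_mul_cancel₀ _ hκ.ne').symm
  have hmin : ∀ w' ∈ stripStabilizer cs 1 i, ∀ c' : ℝ, 0 < c' → TranslatesMiddleLine cs 1 i w' c' →
      t.period i / κ ≤ c' := by
    intro w' hw' c' hc' htrans
    obtain ⟨y, hy⟩ := mem_stripStabilizer_one_iff.mp hw'
    rw [hy.translatesMiddleLine_one_iff] at htrans
    have hy0 : (0 : ℝ) < y := htrans ▸ mul_pos hc' hκ
    rw [div_le_iff₀ hκ, ← htrans, Int.cast_le]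
    exact Int.le_of_dvd (Int.cast_pos.mp hy0) hy.period_dvd_and_map_normalRoot_eq.1
  constructor
  · rintro ⟨hw, c, hc, htrans, hle⟩
    obtain ⟨y, hy⟩ := mem_stripStabilizer_one_iff.mp hw
    have hceq : c = t.period i / κ :=
      (hle _ hvmem _ (div_pos hpos hκ) hvtrans).antisymm (hmin _ hw _ hc htrans)
    rw [hy.translatesMiddleLine_one_iff, hceq, div_mul_cancel₀ _ hκ.ne', Int.cast_inj] at htrans
    exact (htrans ▸ hy).unique hv
  · rintro rfl
    exact ⟨hvmem, _, div_pos hpos hκ, hvtrans, hmin⟩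

end IsStripTranslation

end StripGenerators

section Conjugation

open AffineType

variable {W : Type*} [Group W] {t : AffineType} {cs : CoxeterSystem t.coxeterMatrix W}
variable {i : Fin 2}

theorem middleLine_image (e : ℂ ≃ᵃⁱ[ℝ] ℂ) (T : Set ℂ) :
    middleLine (e '' T) = e '' middleLine T := by
  ext z
  obtain ⟨z, rfl⟩ := e.surjective z
  have hcomm : Equiv.pointReflection (e z) ∘ e = e ∘ Equiv.pointReflection z :=
    funext fun x => by
      simp only [Function.comp_apply, Equiv.pointReflection_apply, AffineIsometryEquiv.map_vadd,
        AffineIsometryEquiv.map_vsub]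
  rw [e.injective.mem_set_image, middleLine, Set.mem_ofPred_eq, ← Set.image_comp, hcomm,
    Set.image_comp, e.injective.image_injective.eq_iff, middleLine, Set.mem_ofPred_eq]

theorem strip_eq_image_strip_one (g : W) : strip cs g i = planeAction cs g '' strip cs 1 i := by
  rw [strip_one, strip]

theorem planeAction_conj_apply (g w : W) (z : ℂ) :
    planeAction cs g (planeAction cs (g⁻¹ * w * g) z) = planeAction cs w (planeAction cs g z) := by
  simp only [← Function.comp_apply (f := planeAction cs _), ← AffineIsometryEquiv.coe_mul,
      ← map_mul, mul_assoc, mul_inv_cancel_left]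

theorem linearIsometryEquiv_conj_apply (g w : W) (d : ℂ) :
    (planeAction cs g).linearIsometryEquiv ((planeAction cs (g⁻¹ * w * g)).linearIsometryEquiv d) =
      (planeAction cs w).linearIsometryEquiv ((planeAction cs g).linearIsometryEquiv d) := by
  have h := planeAction_conj_apply (cs := cs) g w (d +ᵥ (0 : ℂ))
  simp only [AffineIsometryEquiv.map_vadd, planeAction_conj_apply] at h
  exact vadd_right_cancel _ h

theorem stripDirection_eq (g : W) : stripDirection cs g i =
    (planeAction cs g).linearIsometryEquiv (stripDirection cs 1 i) := by
  rw [stripDirection_one, stripDirection]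

theorem mem_stripStabilizer_iff_conj (g w : W) :
    w ∈ stripStabilizer cs g i ↔ g⁻¹ * w * g ∈ stripStabilizer cs 1 i := by
  have hcomp : planeAction cs g ∘ planeAction cs (g⁻¹ * w * g) =
      planeAction cs w ∘ planeAction cs g :=
    funext (planeAction_conj_apply g w)
  refine and_congr ?_ ?_
  · rw [← (planeAction cs g).injective.image_injective.eq_iff (b := strip cs 1 i),
      ← Set.image_comp, hcomp, Set.image_comp, ← strip_eq_image_strip_one]
  · rw [← (planeAction cs g).linearIsometryEquiv.injective.eq_iff (b := stripDirection cs 1 i),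
      linearIsometryEquiv_conj_apply, stripDirection_eq]

theorem translatesMiddleLine_iff_conj (g w : W) (c : ℝ) :
    TranslatesMiddleLine cs g i w c ↔ TranslatesMiddleLine cs 1 i (g⁻¹ * w * g) c := by
  rw [TranslatesMiddleLine, strip_eq_image_strip_one, middleLine_image, Set.forall_mem_image,
    stripDirection_eq, TranslatesMiddleLine]
  refine forall₂_congr fun z _ => ?_
  have hz : planeAction cs g z +
        c • (planeAction cs g).linearIsometryEquiv (stripDirection cs 1 i) =
      planeAction cs g (z + c • stripDirection cs 1 i) := by
    rw [add_comm, add_comm z, ← map_smul, ← vadd_eq_add, ← vadd_eq_add,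
      AffineIsometryEquiv.map_vadd]
  rw [hz, ← planeAction_conj_apply, (planeAction cs g).injective.eq_iff]

theorem isMinimalTranslation_iff_conj (g w : W) :
    IsMinimalTranslation cs g i w ↔ IsMinimalTranslation cs 1 i (g⁻¹ * w * g) := by
  have hconj : Function.Surjective fun w => g⁻¹ * w * g := fun w => ⟨g * w * g⁻¹, by group⟩
  refine and_congr (mem_stripStabilizer_iff_conj g w) <| exists_congr fun c => and_congr_right' <|
    and_congr (translatesMiddleLine_iff_conj g w c) <| .trans ?_ hconj.forall.symm
  simp only [mem_stripStabilizer_iff_conj g, translatesMiddleLine_iff_conj g]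

theorem isStripTranslation_stripWord (i : Fin 2) : IsStripTranslation cs i
    ((standardShift cs i)⁻¹ * cs.wordProd (t.stripWord i) * standardShift cs i) (t.period i) := by
  obtain ⟨ω, hω, hn, ht⟩ : ∃ ω : List (Fin 3),
      (standardShift cs i)⁻¹ * cs.wordProd (t.stripWord i) * standardShift cs i = cs.wordProd ω ∧
      ((∀ l, t.rootAction ω (normalRoot i) l = normalRoot i l) ∨
        ∀ l, t.rootAction ω (normalRoot i) l = (t.delta - normalRoot i) l) ∧
      ∀ l, t.rootAction ω (t.tangentVector i) l =
        (t.tangentVector i - t.period i • t.delta) l := by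
    have hone (ω : List (Fin 3)) : (1 : W)⁻¹ * cs.wordProd ω * 1 = cs.wordProd ω := by simp
    cases t with
    | G2 =>
      fin_cases i
      · refine ⟨[0, 2, 0, 1, 0], ?_, by decide +kernel, by decide +kernel⟩
        simp [standardShift, stripWord, cs.wordProd_cons, mul_assoc]
      · exact ⟨_, hone _, by decide +kernel, by decide +kernel⟩
    | _ => fin_cases i <;> exact ⟨_, hone _, by decide +kernel, by decide +kernel⟩
  rw [hω]
  constructor <;> rw [rootRep_wordProd]
  exacts [hn.imp funext funext, funext ht]

theorem isStripGenerator_iff (i : Fin 2) (w : W) :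
    IsStripGenerator cs i w ↔ w = cs.wordProd (t.stripWord i) := by
  rw [IsStripGenerator, isMinimalTranslation_iff_conj,
    (isStripTranslation_stripWord i).isMinimalTranslation_one_iff, mul_left_inj, mul_right_inj]

end Conjugation

end

theorem mainTheorem2 (t : AffineType) {W : Type*} [Group W]
    (cs : CoxeterSystem t.coxeterMatrix W) :
    (∀ i : Fin 2, ∃! w : W, IsStripGenerator cs i w) ∧
    ∀ w : Fin 2 → W, (∀ i, IsStripGenerator cs i (w i)) →
      ∀ {k : Type*} [CommRing k] (q : k) {V : Type*} [AddCommGroup V] [Module k V]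
        (ρ : HeckeAlgebra cs q →ₐ[k] Module.End k V),
        ∃ l : List FactorLabel, l.Nodup ∧ (∀ x, x ∈ l) ∧
          ((l.map (factor cs ρ w)).prod : PowerSeries (Module.End k V)) =
            poincareSeries cs ρ Set.univ := by
  refine ⟨fun i => ⟨_, (isStripGenerator_iff i _).mpr rfl, fun w => (isStripGenerator_iff i w).mp⟩,
    fun w hw k _ q V _ _ ρ => ?_⟩
  obtain rfl : w = fun i => cs.wordProd (t.stripWord i) :=
    funext fun i => (isStripGenerator_iff i _).mp (hw i)
  exact hasFactorization ρ
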